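/- Let $n\ge 2$, let $M$ be a smooth ($C^\infty$) $n$-dimensional manifold (Hausdorff, second countable, without boundary), and let $2\le k\le\infty$. Let $(\Omega,T,F)$ be a cone triple of class $C^k$ on $M$: $\Omega$ is a (necessarily non-vanishing) $C^k$ one-form, $T$ is a $C^k$ vector field with $\Omega(T)\equiv 1$, and $F$ is a $C^k$ Finsler metric on the vector bundle $\ker\Omega\subset TM$, i.e. $F$ vanishes on the zero section, is positive and $C^k$ on $\ker\Omega\setminus\mathbf 0$, satisfies $F(\lambda v)=\lambda F(v)$ for $\lambda>0$, and for each $p$ and $0\ne v\in\ker\Omega_p$ the fundamental tensor $$g_v(u,w)=\tfrac12\,\tfrac{\partial^2}{\partial r\,\partial s}F(v+ru+sw)^2\big|_{r=s=0},\qquad u,w\in\ker\Omega_p,$$ is positive definite. Let $\pi(v)=v-\Omega(v)T$ be the projection $TM\to\ker\Omega$, let $A=\{v\in TM:\ F(\pi(v))<\Omega(v)\}$ be the cone domain, whose fibre $A_p$ is the convex interior of the cone $\mathcal C_p=\{v\in T_pM\setminus\{0\}: v=F(\pi(v))T_p+\pi(v)\}$, let $G(v)=\Omega(v)^2-F(\pi(v))^2$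 be the associated continuous Lorentz-Finsler metric, and let $\Sigma=\{v\in TM:\ G(v)=1,\ \Omega(v)>0\}$ be its indicatrix. Let $\mathcal U\subset TM$ be any neighbourhood of (the image of) the section $T$. Then there is an embedded hypersurface $\tilde\Sigma\subset TM$ of class $C^k$, contained in $A$, such that: (a) $\tilde\Sigma=\Sigma$ in $TM$ away from $\mathcal U$, i.e. $\tilde\Sigma\setminus\mathcal U=\Sigma\setminus\mathcal U$. (b) Write $\tilde\Sigma_p=\tilde\Sigma\cap T_pM$. For every $p\in M$, each radial direction $\{\lambda v:\lambda>0\}$, $v\in A_p$, crosses $\tilde\Sigma_p$ at exactly one point. At each $v\in\tilde\Sigma_p$ the crossing is transverse: the vertical vector at $v$ determined by $v$ itself is not in $T_v\tilde\Sigma$; in particular $\tilde\Sigma$ is transverse to $T_pM$, $\tilde\Sigma_p$ is a hypersurface of $T_pM$, and $v\notin T_v\tilde\Sigma_p$. Moreover $\tilde\Sigma_p$ is strongly convex with respect to the position vector everywhere: for every $v\in\tilde\Sigma_p$ the second fundamental form $\sigma^v$ of $\tilde\Sigma_p$ as an affine hypersurface of $T_pM$ (defined by $D_XY=(\text{tangent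 part})+\sigma^v(X,Y)\,v$ for tangent fields $X,Y$ of $\tilde\Sigma_p$) is positive definite on $T_v\tilde\Sigma_p$. -/

import Mathlib

open scoped Manifold ContDiff Topology

noncomputable section

/-- The mixed second derivative `∂²/∂r∂s L(v + r u + s w)` at `r = s = 0`. -/
def secondLineDeriv {V : Type*} [AddCommGroup V] [Module ℝ V] (L : V → ℝ) (v u w : V) : ℝ :=
  deriv (fun r : ℝ => deriv (fun s : ℝ => L (v + r • u + s • w)) 0) 0

/-- The fundamental tensor `g_v(u, w) = ½ ∂²/∂r∂s L(v + r u + s w)` at `r = s = 0` of a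
two-homogeneous function `L`. -/
def fundamentalTensor {V : Type*} [AddCommGroup V] [Module ℝ V] (L : V → ℝ) (v u w : V) : ℝ :=
  (1 / 2) * secondLineDeriv L v u w

/-- A cone triple `(Ω, T, F)` of class `C^k` on `M`: a one-form `Ω`, a vector field `T` with
`Ω(T) = 1` and a Finsler metric `F` on the vector bundle `ker Ω`. Only the values of `F` on
vectors of `ker Ω` are relevant. That `Ω` does not vanish anywhere follows from `Ω(T) = 1`. -/
structure ConeTriple (n : ℕ) (M : Type*) [TopologicalSpace M]
    [ChartedSpace (EuclideanSpace ℝ (Fin n)) M] [IsManifold (𝓡 n) ∞ M] (k : ℕ∞) where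
  /-- the one-form -/
  Ω : Cₛ^k⟮𝓡 n; EuclideanSpace ℝ (Fin n) →L[ℝ] ℝ,
    fun p : M => TangentSpace (𝓡 n) p →L[ℝ] Bundle.Trivial M ℝ p⟯
  /-- the vector field -/
  T : Cₛ^k⟮𝓡 n; EuclideanSpace ℝ (Fin n), fun p : M => TangentSpace (𝓡 n) p⟯
  /-- the Finsler metric on `ker Ω` (one-homogeneous version) -/
  F : TangentBundle (𝓡 n) M → ℝ
  Ω_T : ∀ p : M, Ω p (T p) = (1 : ℝ)
  F_zero : ∀ p : M, F ⟨p, 0⟩ = 0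
  F_pos : ∀ (p : M) (v : TangentSpace (𝓡 n) p), Ω p v = (0 : ℝ) → v ≠ 0 → 0 < F ⟨p, v⟩
  F_smul : ∀ (p : M) (v : TangentSpace (𝓡 n) p) (a : ℝ), Ω p v = (0 : ℝ) → 0 < a →
    F ⟨p, a • v⟩ = a * F ⟨p, v⟩
  F_contMDiffOn : ContMDiffOn (𝓡 n).tangent 𝓘(ℝ, ℝ) k F
    {v : TangentBundle (𝓡 n) M | Ω v.proj v.snd = (0 : ℝ) ∧ v.snd ≠ 0}
  F_posDef : ∀ (p : M) (v u : TangentSpace (𝓡 n) p), Ω p v = (0 : ℝ) → v ≠ 0 →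
    Ω p u = (0 : ℝ) → u ≠ 0 →
    0 < fundamentalTensor (fun w : TangentSpace (𝓡 n) p => F ⟨p, w⟩ ^ 2) v u u

namespace ConeTriple

/-- `Ω` as a real function on the tangent bundle. -/
def form {n : ℕ} {M : Type*} [TopologicalSpace M] [ChartedSpace (EuclideanSpace ℝ (Fin n)) M]
    [IsManifold (𝓡 n) ∞ M] {k : ℕ∞} (c : ConeTriple n M k) (v : TangentBundle (𝓡 n) M) : ℝ :=
  c.Ω v.proj v.snd

/-- The vector field `T` as a map `M → TM`. -/
def field {n : ℕ} {M : Type*} [TopologicalSpace M] [ChartedSpace (EuclideanSpace ℝ (Fin n)) M]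
    [IsManifold (𝓡 n) ∞ M] {k : ℕ∞} (c : ConeTriple n M k) (p : M) : TangentBundle (𝓡 n) M :=
  ⟨p, c.T p⟩

/-- The projection `π : TM → ker Ω`, `π(v) = v - Ω(v) T`. -/
def proj {n : ℕ} {M : Type*} [TopologicalSpace M] [ChartedSpace (EuclideanSpace ℝ (Fin n)) M]
    [IsManifold (𝓡 n) ∞ M] {k : ℕ∞} (c : ConeTriple n M k) (v : TangentBundle (𝓡 n) M) :
    TangentBundle (𝓡 n) M :=
  ⟨v.proj, v.snd - c.form v • c.T v.proj⟩

/-- The continuous Lorentz-Finsler metric `G(t T + w) = t² - F(w)²`, `t ∈ ℝ`, `w ∈ ker Ω`. -/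
def lorentz {n : ℕ} {M : Type*} [TopologicalSpace M] [ChartedSpace (EuclideanSpace ℝ (Fin n)) M]
    [IsManifold (𝓡 n) ∞ M] {k : ℕ∞} (c : ConeTriple n M k) (v : TangentBundle (𝓡 n) M) : ℝ :=
  c.form v ^ 2 - c.F (c.proj v) ^ 2

/-- The indicatrix `Σ = G⁻¹(1) ∩ Ω⁻¹((0, ∞))`. -/
def indicatrix {n : ℕ} {M : Type*} [TopologicalSpace M]
    [ChartedSpace (EuclideanSpace ℝ (Fin n)) M] [IsManifold (𝓡 n) ∞ M] {k : ℕ∞}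
    (c : ConeTriple n M k) : Set (TangentBundle (𝓡 n) M) :=
  {v | c.lorentz v = 1 ∧ 0 < c.form v}

/-- The cone domain `A`: the union over `p` of the convex interiors of the cones
`C_p = {v ≠ 0 | v = F(π(v)) T + π(v)} = {v ≠ 0 | Ω(v) = F(π(v))}`. -/
def coneDomain {n : ℕ} {M : Type*} [TopologicalSpace M]
    [ChartedSpace (EuclideanSpace ℝ (Fin n)) M] [IsManifold (𝓡 n) ∞ M] {k : ℕ∞}
    (c : ConeTriple n M k) : Set (TangentBundle (𝓡 n) M) :=
  {v | c.F (c.proj v) < c.form v}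

end ConeTriple

/-- `f` is a `C^k` regular local equation of the subset `S` of the manifold `N` around `x`. -/
def IsLocalEquation {E H N : Type*} [NormedAddCommGroup E] [NormedSpace ℝ E]
    [TopologicalSpace H] (J : ModelWithCorners ℝ E H) [TopologicalSpace N] [ChartedSpace H N]
    (k : ℕ∞) (S : Set N) (x : N) (f : N → ℝ) : Prop :=
  ∃ W : Set N, IsOpen W ∧ x ∈ W ∧ ContMDiffOn J 𝓘(ℝ, ℝ) k f W ∧
    (∀ y ∈ W, mfderiv J 𝓘(ℝ, ℝ) f y ≠ 0) ∧ ∀ y ∈ W, y ∈ S ↔ f y = 0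

/-- `S` is an embedded hypersurface of class `C^k` of the manifold `N` (without boundary):
around each of its points it has a `C^k` regular local equation. -/
def IsHypersurface {E H N : Type*} [NormedAddCommGroup E] [NormedSpace ℝ E]
    [TopologicalSpace H] (J : ModelWithCorners ℝ E H) [TopologicalSpace N] [ChartedSpace H N]
    (k : ℕ∞) (S : Set N) : Prop :=
  ∀ x ∈ S, ∃ f : N → ℝ, IsLocalEquation J k S x f

/-- Restriction of a function on `TM` to the fibre `T_pM`. -/
def fibreRestrict {n : ℕ} {M : Type*} [TopologicalSpace M]
    [ChartedSpace (EuclideanSpace ℝ (Fin n)) M] (f : TangentBundle (𝓡 n) M → ℝ) (p : M) :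
    TangentSpace (𝓡 n) p → ℝ :=
  fun w => f ⟨p, w⟩

/-- The radial direction at `v` is transverse to the hypersurface `S ⊆ TM`: the
vertical vector at `v` given by `v` itself does not lie in `T_v S = ker df_v`. In particular `S` is
transverse to the fibre `T_pM` at `v`, and the radial direction is transverse to the
hypersurface `S_p = S ∩ T_pM` of `T_pM`. This does not depend on the local equation `f`. -/
def IsRadiallyTransverseAt {n : ℕ} {M : Type*} [TopologicalSpace M]
    [ChartedSpace (EuclideanSpace ℝ (Fin n)) M] [IsManifold (𝓡 n) ∞ M] (k : ℕ∞)
    (S : Set (TangentBundle (𝓡 n) M)) (v : TangentBundle (𝓡 n) M) : Prop :=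
  ∃ f : TangentBundle (𝓡 n) M → ℝ, IsLocalEquation (𝓡 n).tangent k S v f ∧
    lineDeriv ℝ (fibreRestrict f v.proj) v.snd v.snd ≠ 0

/-- The second fundamental form `σ^v` at `v` of the affine hypersurface `{h = 0}` of a vector space,
with respect to the position vector `v`, assumed transverse to it: for tangent fields `X`, `Y`,
`D_X Y = (tangent part) + σ^v(X, Y) v`, so that `0 = D²h(X, Y) + σ^v(X, Y) dh(v)`. -/
def positionSecondFundamentalForm {V : Type*} [AddCommGroup V] [Module ℝ V] (h : V → ℝ)
    (v X Y : V) : ℝ :=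
  -secondLineDeriv h v X Y / lineDeriv ℝ h v v

/-- The fibre `S_p = S ∩ T_pM` of the hypersurface `S ⊆ TM` is, at its point `v`, strongly convex
with respect to the position vector: the position vector is transverse to `S_p` and the second
fundamental form of `S_p` with respect to it is positive definite on the tangent space of `S_p`.
This does not depend on the local equation `f`. -/
def IsFibreStronglyConvexAt {n : ℕ} {M : Type*} [TopologicalSpace M]
    [ChartedSpace (EuclideanSpace ℝ (Fin n)) M] [IsManifold (𝓡 n) ∞ M] (k : ℕ∞)
    (S : Set (TangentBundle (𝓡 n) M)) (v : TangentBundle (𝓡 n) M) : Prop :=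
  ∃ f : TangentBundle (𝓡 n) M → ℝ, IsLocalEquation (𝓡 n).tangent k S v f ∧
    lineDeriv ℝ (fibreRestrict f v.proj) v.snd v.snd ≠ 0 ∧
    ∀ X : TangentSpace (𝓡 n) v.proj, X ≠ 0 →
      lineDeriv ℝ (fibreRestrict f v.proj) v.snd X = 0 →
      0 < positionSecondFundamentalForm (fibreRestrict f v.proj) v.snd X X

end

noncomputable section

open Bundle

/-! Over `ker Ω` the indicatrix `Σ` is the graph `Ω = √(1 + F²)`, where `F` stands for `F ∘ π`.
Smoothness can fail only where `F = 0`, that is along the `T`-direction, because `F²` need not be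
`C²` at the zero section. The cure is to replace `√(1 + F²)` by a regularized maximum `φ` of `y =
√(1 + F²)` and `x = √(1 + α + b)`. Here `b = B(π v, π v)` for a Riemannian metric `B` with `4B ≤ F²`
on `ker Ω`, and `α` is a positive function on `M`. The new hypersurface is `f = Ω - φ = 0`.

The regularization is `φ = y + ε r((x - y)/ε)` with `ε = α/6` and `r` a convex ramp with slopes in
`[0, 1]`. Where `F` is small, `x - y > ε`, so `φ` is `x` minus a function of the base point and `F`
drops out: `φ` is `C^k`. Where `F² ≥ α + b`, `φ = y` and nothing has changed. The modified region
has `F² < α + b ≤ α + F²/4`, hence `F² < 2α`, and a small `α` puts it inside `U`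
(`exists_smooth_size`).

Convexity passes to `φ`: its second derivative along a line transverse to `T` is `(1 - τ) y'' + τ
x''` plus a nonnegative term, where `τ = r'` lies in `[0, 1]`. That `x''` and `y''` are positive
comes from the Cauchy-Schwarz inequality for `B` and for the fundamental tensor of `F`
(`sq_le_of_homogeneous`).

Transversality is the inequality `dφ(v) < φ(v)` (`smoothedProfile.hasDerivAt_ray`), so `df(v) > 0`
on the hypersurface. It also makes `φ(a v)/a` strictly decreasing in `a`, so a ray meets the
hypersurface at most once; an intermediate value argument gives existence inside the cone. The
second fundamental form is then `D²φ(X, X)/df(v)`, positive because a nonzero tangent `X` cannot be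
a multiple of `T`: `df(T) = 1`. -/

/-- `g` is differentiable near `a`, with `g'(a) = d₁` and `g''(a) = d₂`. -/
def HasTwoDerivsAt (g : ℝ → ℝ) (d₁ d₂ a : ℝ) : Prop :=
  ∃ g' : ℝ → ℝ, (∀ᶠ t in 𝓝 a, HasDerivAt g (g' t) t) ∧ g' a = d₁ ∧ HasDerivAt g' d₂ a

/-! ### Calculus of first and second derivatives along a line. -/

namespace HasTwoDerivsAt

variable {f g : ℝ → ℝ} {a b₁ b₂ d₁ d₂ : ℝ}

theorem hasDerivAt (h : HasTwoDerivsAt g d₁ d₂ a) : HasDerivAt g d₁ a := by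
  obtain ⟨g', h1, h2, -⟩ := h
  exact h2 ▸ h1.self_of_nhds

theorem deriv_deriv (h : HasTwoDerivsAt g d₁ d₂ a) : deriv (deriv g) a = d₂ := by
  obtain ⟨g', h1, -, h3⟩ := h
  have : deriv g =ᶠ[𝓝 a] g' := h1.mono fun t ht => ht.deriv
  rw [this.deriv_eq, h3.deriv]

theorem congr_of_eventuallyEq (h : HasTwoDerivsAt g d₁ d₂ a) (hf : f =ᶠ[𝓝 a] g) :
    HasTwoDerivsAt f d₁ d₂ a := by
  obtain ⟨g', h1, h2, h3⟩ := h
  refine ⟨g', ?_, h2, h3⟩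
  filter_upwards [h1, hf.eventually_nhds] with t ht ht'
  exact ht.congr_of_eventuallyEq ht'

theorem congr_derivs {e₁ e₂ : ℝ} (h : HasTwoDerivsAt g d₁ d₂ a) (h₁ : d₁ = e₁) (h₂ : d₂ = e₂) :
    HasTwoDerivsAt g e₁ e₂ a :=
  h₁ ▸ h₂ ▸ h

theorem of_contDiffAt (h : ContDiffAt ℝ 2 g a) :
    HasTwoDerivsAt g (deriv g a) (deriv (deriv g) a) a := by
  refine ⟨deriv g, ?_, rfl, ?_⟩
  · filter_upwards [h.eventually (by simp)] with t ht
    exact (ht.differentiableAt (by simp)).hasDerivAt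
  · have : ContDiffAt ℝ 1 (deriv g) a := by
      obtain ⟨u, hu, hg⟩ := (contDiffAt_succ_iff_hasFDerivAt (n := 1)).1
        (h.of_le (by norm_num [one_add_one_eq_two]))
      obtain ⟨s, hs, hd⟩ := hu
      have h2 : deriv g =ᶠ[𝓝 a] fun t => u t 1 := by
        filter_upwards [hs] with t ht
        exact (hd t ht).hasDerivAt.deriv
      exact (hg.clm_apply contDiffAt_const).congr_of_eventuallyEq h2
    exact (this.differentiableAt (by simp)).hasDerivAt

theorem const (c : ℝ) : HasTwoDerivsAt (fun _ => c) 0 0 a :=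
  ⟨fun _ => 0, .of_forall fun t => hasDerivAt_const t c, rfl, hasDerivAt_const a 0⟩

theorem id : HasTwoDerivsAt (fun t => t) 1 0 a :=
  ⟨fun _ => 1, .of_forall fun t => hasDerivAt_id t, rfl, hasDerivAt_const a 1⟩

theorem add (hf : HasTwoDerivsAt f b₁ b₂ a) (hg : HasTwoDerivsAt g d₁ d₂ a) :
    HasTwoDerivsAt (fun t => f t + g t) (b₁ + d₁) (b₂ + d₂) a := by
  obtain ⟨f', h1, rfl, h3⟩ := hf
  obtain ⟨g', k1, rfl, k3⟩ := hg
  exact ⟨fun t => f' t + g' t, h1.mp (k1.mono fun t k h => h.add k), rfl, h3.add k3⟩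

theorem mul (hf : HasTwoDerivsAt f b₁ b₂ a) (hg : HasTwoDerivsAt g d₁ d₂ a) :
    HasTwoDerivsAt (fun t => f t * g t) (b₁ * g a + f a * d₁)
      (b₂ * g a + 2 * b₁ * d₁ + f a * d₂) a := by
  have hf0 := hf.hasDerivAt
  have hg0 := hg.hasDerivAt
  obtain ⟨f', h1, rfl, h3⟩ := hf
  obtain ⟨g', k1, rfl, k3⟩ := hg
  refine ⟨fun t => f' t * g t + f t * g' t, h1.mp (k1.mono fun t k h => h.mul k), rfl, ?_⟩
  exact ((h3.mul hg0).add (hf0.mul k3)).congr_deriv (by ring)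

theorem comp (hf : HasTwoDerivsAt f b₁ b₂ (g a)) (hg : HasTwoDerivsAt g d₁ d₂ a) :
    HasTwoDerivsAt (fun t => f (g t)) (b₁ * d₁) (b₂ * d₁ ^ 2 + b₁ * d₂) a := by
  have hg0 := hg.hasDerivAt
  obtain ⟨f', h1, rfl, h3⟩ := hf
  obtain ⟨g', k1, rfl, k3⟩ := hg
  refine ⟨fun t => f' (g t) * g' t, ?_, rfl, ?_⟩
  · filter_upwards [hg0.continuousAt.eventually h1, k1] with t h k
    exact h.comp t k
  · exact ((h3.comp a hg0).mul k3).congr_deriv (by simp only [Function.comp]; ring)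

theorem sqrt (hg : HasTwoDerivsAt g d₁ d₂ a) (h : 0 < g a) :
    HasTwoDerivsAt (fun t => √(g t)) (d₁ / (2 * √(g a)))
      ((2 * g a * d₂ - d₁ ^ 2) / (4 * g a * √(g a))) a := by
  have hs : 0 < √(g a) := Real.sqrt_pos.2 h
  have hsq := Real.sq_sqrt h.le
  have key : HasTwoDerivsAt Real.sqrt (1 / (2 * √(g a))) (-1 / (4 * g a * √(g a))) (g a) := by
    refine ⟨fun t => 1 / (2 * √t), ?_, rfl, ?_⟩
    · filter_upwards [lt_mem_nhds h] with t ht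
      exact Real.hasDerivAt_sqrt ht.ne'
    · have := ((Real.hasDerivAt_sqrt h.ne').const_mul 2).fun_inv (by positivity)
      simp only [one_div]
      refine this.congr_deriv ?_
      field_simp
      linear_combination 4 * hsq
  refine (key.comp hg).congr_derivs (by field_simp) ?_
  field_simp
  ring

end HasTwoDerivsAt

/-- Second derivative of `√(b + ℓ)` is positive when `ℓ` is convex enough along a line. -/
theorem HasTwoDerivsAt.sqrt_const_add {ℓ : ℝ → ℝ} {b d₁ d₂ a : ℝ} (hb : 0 < b)
    (h : HasTwoDerivsAt ℓ d₁ d₂ a) (h0 : 0 ≤ ℓ a) (h2 : 0 < d₂) (h12 : d₁ ^ 2 ≤ 2 * ℓ a * d₂) :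
    ∃ e₁ e₂, HasTwoDerivsAt (fun t => √(b + ℓ t)) e₁ e₂ a ∧ 0 < e₂ := by
  refine ⟨_, _, ((HasTwoDerivsAt.const b).add h).sqrt (by positivity), ?_⟩
  have : 0 < √(b + ℓ a) := Real.sqrt_pos.2 (by positivity)
  refine div_pos ?_ (by positivity)
  -- The numerator is `2 b d₂ + (2 ℓ d₂ - d₁²)`: Cauchy-Schwarz makes the bracket nonnegative, and
  -- `b > 0` makes the sum strictly positive.
  nlinarith [mul_pos hb h2]

/-! ### The convex ramp. -/

/-- A smooth convex function which vanishes on `(-∞, 0]` and has slope one on `[1, ∞)`. -/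
def smoothRamp (s : ℝ) : ℝ := ∫ t in (0 : ℝ)..s, Real.smoothTransition t

namespace smoothRamp

theorem hasDerivAt (s : ℝ) : HasDerivAt smoothRamp (Real.smoothTransition s) s :=
  Real.smoothTransition.continuous.integral_hasStrictDerivAt 0 s |>.hasDerivAt

theorem contDiff (k : ℕ∞) : ContDiff ℝ k smoothRamp := by
  have : ContDiff ℝ ∞ smoothRamp := by
    rw [contDiff_infty_iff_deriv]
    refine ⟨fun s => (hasDerivAt s).differentiableAt, ?_⟩
    rw [show deriv smoothRamp = Real.smoothTransition from funext fun s => (hasDerivAt s).deriv]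
    exact Real.smoothTransition.contDiff (n := ⊤)
  exact this.of_le (mod_cast le_top)

theorem hasTwoDerivsAt (s : ℝ) :
    ∃ e, HasTwoDerivsAt smoothRamp (Real.smoothTransition s) e s ∧ 0 ≤ e := by
  refine ⟨deriv Real.smoothTransition s, ⟨Real.smoothTransition, .of_forall hasDerivAt, rfl, ?_⟩,
    Real.smoothTransition.monotone.deriv_nonneg⟩
  exact ((Real.smoothTransition.contDiff (n := 1)).differentiable (by simp) s).hasDerivAt

theorem of_nonpos {s : ℝ} (hs : s ≤ 0) : smoothRamp s = 0 := by
  unfold smoothRamp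
  rw [intervalIntegral.integral_congr (g := fun _ => 0)]
  · simp
  · intro t ht
    rw [Set.uIcc_of_ge hs] at ht
    exact Real.smoothTransition.zero_of_nonpos ht.2

theorem monotone : Monotone smoothRamp :=
  monotone_of_deriv_nonneg (fun s => (hasDerivAt s).differentiableAt) fun s => by
    rw [(hasDerivAt s).deriv]; exact Real.smoothTransition.nonneg s

theorem nonneg (s : ℝ) : 0 ≤ smoothRamp s := by
  rcases le_total s 0 with h | h
  · exact (of_nonpos h).ge
  · exact (of_nonpos le_rfl).ge.trans (monotone h)

theorem sub_le_sub {s t : ℝ} (h : s ≤ t) : smoothRamp t - smoothRamp s ≤ t - s := by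
  have : Monotone fun s => s - smoothRamp s :=
    monotone_of_deriv_nonneg
      (fun s => ((hasDerivAt_id s).sub (hasDerivAt s)).differentiableAt) fun s => by
        rw [((hasDerivAt_id' s).fun_sub (hasDerivAt s)).deriv]
        linarith [Real.smoothTransition.le_one s]
  have := this h
  simp only at this
  linarith

theorem le_self {s : ℝ} (hs : 0 ≤ s) : smoothRamp s ≤ s := by
  have := sub_le_sub hs
  rw [of_nonpos le_rfl] at this
  linarith

theorem of_one_le {s : ℝ} (hs : 1 ≤ s) : smoothRamp s = s - (1 - smoothRamp 1) := by
  have h : smoothRamp s - smoothRamp 1 = s - 1 := by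
    unfold smoothRamp
    rw [intervalIntegral.integral_interval_sub_left
      (Real.smoothTransition.continuous.intervalIntegrable _ _)
      (Real.smoothTransition.continuous.intervalIntegrable _ _),
      intervalIntegral.integral_congr (g := fun _ => 1)]
    · simp
    · intro t ht
      rw [Set.uIcc_of_le hs] at ht
      exact Real.smoothTransition.one_of_one_le ht.1
  linarith

/-- Bounds the intercept at `0` of the tangent line to the ramp: on `[0, 1]` one has `r ≥ 0` and `r'
s ≤ 1`, and beyond `1` the intercept is constant. This is the most that the regularization can cost
in the transversality estimate. -/
theorem neg_one_le_sub (s : ℝ) : -1 ≤ smoothRamp s - Real.smoothTransition s * s := by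
  rcases le_total s 0 with h | h
  · rw [of_nonpos h, Real.smoothTransition.zero_of_nonpos h]; norm_num
  rcases le_total s 1 with h1 | h1
  · nlinarith [nonneg s, Real.smoothTransition.le_one s, Real.smoothTransition.nonneg s]
  · rw [of_one_le h1, Real.smoothTransition.one_of_one_le h1]
    linarith [nonneg 1]

end smoothRamp

/-! ### The regularized maximum as a function of real parameters. -/

/-- The graph function of the smoothed indicatrix: a regularized maximum of `√(1 + α + b)` and
`√(1 + ℓ)`, where `b` is a squared Euclidean norm and `ℓ` a squared Finsler norm. -/
def smoothedProfile (α b ℓ : ℝ) : ℝ :=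
  √(1 + ℓ) + α / 6 * smoothRamp ((√(1 + α + b) - √(1 + ℓ)) / (α / 6))

namespace smoothedProfile

variable {α b ℓ : ℝ}

theorem sqrt_le (hα : 0 < α) : √(1 + ℓ) ≤ smoothedProfile α b ℓ := by
  have := smoothRamp.nonneg ((√(1 + α + b) - √(1 + ℓ)) / (α / 6))
  unfold smoothedProfile
  nlinarith

theorem eq_sqrt (hα : 0 < α) (h : α + b ≤ ℓ) : smoothedProfile α b ℓ = √(1 + ℓ) := by
  unfold smoothedProfile
  rw [smoothRamp.of_nonpos]
  · simp
  · exact div_nonpos_of_nonpos_of_nonneg (sub_nonpos.2 (Real.sqrt_le_sqrt (by linarith)))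
      (by positivity)

theorem le_sqrt (hα : 0 < α) (h : ℓ ≤ α + b) : smoothedProfile α b ℓ ≤ √(1 + α + b) := by
  have h0 : √(1 + ℓ) ≤ √(1 + α + b) := Real.sqrt_le_sqrt (by linarith)
  have := smoothRamp.le_self (s := (√(1 + α + b) - √(1 + ℓ)) / (α / 6))
    (div_nonneg (sub_nonneg.2 h0) (by positivity))
  rw [le_div_iff₀ (by positivity)] at this
  unfold smoothedProfile
  linarith

/-- Where the ramp has slope one, the two copies of `√(1 + ℓ)` cancel. This is what removes the
nonsmooth `F²` near the zero section. -/
theorem eq_sqrt_sub (hα : 0 < α) (h : √(1 + ℓ) + α / 6 ≤ √(1 + α + b)) :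
    smoothedProfile α b ℓ = √(1 + α + b) - α / 6 * (1 - smoothRamp 1) := by
  unfold smoothedProfile
  rw [smoothRamp.of_one_le]
  · field_simp
    ring
  · rw [le_div_iff₀ (by positivity)]; linarith

/-- With `τ` and `e` the first and second derivatives of the ramp, the second derivative of the
profile is `(1 - τ) y₂ + τ x₂ + e (x₁ - y₁)² / (α/6)`: a convex combination of two positive numbers
plus a nonnegative term. -/
theorem hasTwoDerivsAt {b ℓ : ℝ → ℝ} {b₁ b₂ l₁ l₂ a : ℝ} (hα : 0 < α)
    (hb : HasTwoDerivsAt b b₁ b₂ a) (hl : HasTwoDerivsAt ℓ l₁ l₂ a)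
    (hb0 : 0 ≤ b a) (hb2 : 0 < b₂) (hb12 : b₁ ^ 2 ≤ 2 * b a * b₂)
    (hl0 : 0 ≤ ℓ a) (hl2 : 0 < l₂) (hl12 : l₁ ^ 2 ≤ 2 * ℓ a * l₂) :
    ∃ e₁ e₂, HasTwoDerivsAt (fun t => smoothedProfile α (b t) (ℓ t)) e₁ e₂ a ∧ 0 < e₂ := by
  obtain ⟨x₁, x₂, hx, hx2⟩ := hb.sqrt_const_add (b := 1 + α) (by linarith) hb0 hb2 hb12
  obtain ⟨y₁, y₂, hy, hy2⟩ := hl.sqrt_const_add one_pos hl0 hl2 hl12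
  have hs : HasTwoDerivsAt (fun t => (√(1 + α + b t) - √(1 + ℓ t)) / (α / 6))
      ((x₁ - y₁) / (α / 6)) ((x₂ - y₂) / (α / 6)) a := by
    refine ((((HasTwoDerivsAt.const (α / 6)⁻¹).mul
      (hx.add ((HasTwoDerivsAt.const (-1)).mul hy)))).congr_of_eventuallyEq
      (.of_forall fun t => ?_)).congr_derivs ?_ ?_
    · simp only [div_eq_inv_mul]; ring
    · simp only [div_eq_inv_mul]; ring
    · simp only [div_eq_inv_mul]; ring
  obtain ⟨e, he, he0⟩ := smoothRamp.hasTwoDerivsAt ((√(1 + α + b a) - √(1 + ℓ a)) / (α / 6))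
  refine ⟨_, _, hy.add ((HasTwoDerivsAt.const (α / 6)).mul (HasTwoDerivsAt.comp
    (g := fun t => (√(1 + α + b t) - √(1 + ℓ t)) / (α / 6)) he hs)), ?_⟩
  set τ := Real.smoothTransition ((√(1 + α + b a) - √(1 + ℓ a)) / (α / 6))
  have h0 : 0 ≤ τ := Real.smoothTransition.nonneg _
  have h1 : τ ≤ 1 := Real.smoothTransition.le_one _
  have : α / 6 * (e * ((x₁ - y₁) / (α / 6)) ^ 2 + τ * ((x₂ - y₂) / (α / 6)))
      = α / 6 * (e * ((x₁ - y₁) / (α / 6)) ^ 2) + τ * (x₂ - y₂) := by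
    field_simp
  have h2 : 0 ≤ α / 6 * (e * ((x₁ - y₁) / (α / 6)) ^ 2) := by positivity
  have h3 : 0 < (1 - τ) * y₂ + τ * x₂ := by
    rcases h0.eq_or_lt with h | h
    · rw [← h]; linarith
    · have := mul_pos h hx2
      nlinarith
  simp only [zero_mul, mul_zero, zero_add]
  nlinarith

/-- Along a ray the profile lies above its tangent through the origin. -/
theorem hasDerivAt_ray {a : ℝ} (hα : 0 < α) (hα1 : α ≤ 1) (hb : 0 ≤ b) (hbl : 4 * b ≤ ℓ) :
    ∃ d, HasDerivAt (fun a => smoothedProfile α (a ^ 2 * b) (a ^ 2 * ℓ)) d a ∧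
      a * d < smoothedProfile α (a ^ 2 * b) (a ^ 2 * ℓ) := by
  have hb' : 0 ≤ a ^ 2 * b := by positivity
  have hl' : 4 * (a ^ 2 * b) ≤ a ^ 2 * ℓ := by nlinarith [sq_nonneg a]
  have hx0 : 0 < 1 + α + a ^ 2 * b := by positivity
  have hy0 : 0 < 1 + a ^ 2 * ℓ := by linarith
  have hx : HasDerivAt (fun a => √(1 + α + a ^ 2 * b)) (a * b / √(1 + α + a ^ 2 * b)) a := by
    refine ((((hasDerivAt_pow 2 a).mul_const b).const_add (1 + α)).sqrt hx0.ne').congr_deriv ?_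
    norm_num
    field_simp
  have hy : HasDerivAt (fun a => √(1 + a ^ 2 * ℓ)) (a * ℓ / √(1 + a ^ 2 * ℓ)) a := by
    refine ((((hasDerivAt_pow 2 a).mul_const ℓ).const_add 1).sqrt hy0.ne').congr_deriv ?_
    norm_num
    field_simp
  refine ⟨_, hy.add (((smoothRamp.hasDerivAt _).comp a
    ((hx.sub hy).div_const (α / 6))).const_mul (α / 6)), ?_⟩
  have hxs := Real.sq_sqrt hx0.le
  have hys := Real.sq_sqrt hy0.le
  have hxp := Real.sqrt_pos.2 hx0
  have hyp := Real.sqrt_pos.2 hy0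
  -- For `x = √(C + a² b)` one has `a x' = x - C/x`, so the tangent at `a` has intercept `C/x > 0`.
  -- The proof bounds the average of these gains for `x` and `y` from below against the loss due to
  -- the ramp.
  have hx1 : a * (a * b / √(1 + α + a ^ 2 * b)) =
      √(1 + α + a ^ 2 * b) - (1 + α) / √(1 + α + a ^ 2 * b) := by
    field_simp
    linarith
  have hy1 : a * (a * ℓ / √(1 + a ^ 2 * ℓ)) = √(1 + a ^ 2 * ℓ) - 1 / √(1 + a ^ 2 * ℓ) := by
    field_simp
    linarith
  unfold smoothedProfile
  simp only [Pi.sub_apply]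
  generalize a * b / √(1 + α + a ^ 2 * b) = x' at *
  generalize a * ℓ / √(1 + a ^ 2 * ℓ) = y' at *
  generalize hX : √(1 + α + a ^ 2 * b) = x at *
  generalize hY : √(1 + a ^ 2 * ℓ) = y at *
  obtain ⟨s, hs⟩ : ∃ s, s = (x - y) / (α / 6) := ⟨_, rfl⟩
  have hsx : x = y + α / 6 * s := by rw [hs]; field_simp; ring
  rw [← hs]
  have e1 : a * (y' + α / 6 * (Real.smoothTransition s * ((x' - y') / (α / 6)))) =
      (1 - Real.smoothTransition s) * (a * y') + Real.smoothTransition s * (a * x') := by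
    field_simp
    ring
  rw [e1, hx1, hy1]
  rcases le_or_gt s 0 with h | h
  · rw [Real.smoothTransition.zero_of_nonpos h, smoothRamp.of_nonpos h]
    have : 0 < 1 / y := by positivity
    linarith
  -- The ramp is active only if `y < x`; then `a² ℓ < α + a² b`, and `4 b ≤ ℓ` with `α ≤ 1` gives `x
  -- ≤ 2`. Both gains are thus at least `1/2`, while the ramp costs at most `α/6 ≤ 1/6`.
  · have hxy : y < x := by rw [hsx]; nlinarith
    have h2 : y ^ 2 < x ^ 2 := by nlinarith
    have hx2 : x ≤ 2 := by nlinarith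
    have ha : 1 / 2 ≤ 1 / y := one_div_le_one_div_of_le hyp (by linarith)
    have hb : 1 / 2 ≤ (1 + α) / x := by
      rw [le_div_iff₀ hxp]; linarith
    have hc := smoothRamp.neg_one_le_sub s
    have h0 := Real.smoothTransition.nonneg s
    have h1 := Real.smoothTransition.le_one s
    set τ := Real.smoothTransition s
    have hd : 1 / 2 ≤ (1 - τ) * (1 / y) + τ * ((1 + α) / x) := by nlinarith
    have he : -(1 / 6) ≤ α / 6 * (smoothRamp s - τ * s) := by nlinarith
    have hf : τ * x = τ * y + α / 6 * (τ * s) := by rw [hsx]; ring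
    nlinarith

/-- A ray of slope greater than `√ℓ` meets the graph of the profile exactly once. -/
theorem existsUnique_ray {t : ℝ} (hα : 0 < α) (hα1 : α ≤ 1) (hb : 0 ≤ b) (hbl : 4 * b ≤ ℓ)
    (ht : 0 < t) (hlt : ℓ < t ^ 2) :
    ∃! a : ℝ, 0 < a ∧ a * t = smoothedProfile α (a ^ 2 * b) (a ^ 2 * ℓ) := by
  set G : ℝ → ℝ := fun a => smoothedProfile α (a ^ 2 * b) (a ^ 2 * ℓ) with hG
  have hd : ∀ a, ∃ d, HasDerivAt G d a ∧ a * d < G a :=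
    fun a => hasDerivAt_ray hα hα1 hb hbl
  have hc : Continuous G := continuous_iff_continuousAt.2 fun a => by
    obtain ⟨d, h, -⟩ := hd a
    exact h.continuousAt
  -- The derivative of `G a / a` is `(a G' - G)/a²`, negative by the tangent estimate.
  have hanti : StrictAntiOn (fun a => G a / a) (Set.Ioi 0) := by
    refine strictAntiOn_of_deriv_neg (convex_Ioi 0)
      (hc.continuousOn.div continuousOn_id fun x hx => (ne_of_gt hx)) fun a ha => ?_
    rw [interior_Ioi] at ha
    obtain ⟨d, h, h'⟩ := hd a
    rw [(h.fun_div (hasDerivAt_id' a) (ne_of_gt ha)).deriv]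
    exact div_neg_of_neg_of_pos (by linarith) (pow_pos ha 2)
  have hex : ∃ a, 0 < a ∧ a * t = G a := by
    -- This `r` solves `√(1 + α + r² ℓ) = r t`; the left side dominates the profile because `b ≤ ℓ`.
    -- Hence the ray is above the graph at `r` and below it at `0`.
    set r := √((1 + α) / (t ^ 2 - ℓ)) with hr
    have hpos : 0 < (1 + α) / (t ^ 2 - ℓ) := div_pos (by linarith) (by linarith)
    have hr0 : 0 < r := Real.sqrt_pos.2 hpos
    have hr2 : r ^ 2 * (t ^ 2 - ℓ) = 1 + α := by
      rw [hr, Real.sq_sqrt hpos.le]; exact div_mul_cancel₀ _ (by linarith)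
    have h1 : G r ≤ r * t := by
      have : √(1 + α + r ^ 2 * ℓ) = r * t := by
        rw [show 1 + α + r ^ 2 * ℓ = (r * t) ^ 2 by linarith]
        exact Real.sqrt_sq (by positivity)
      rw [← this]
      rcases le_total (α + r ^ 2 * b) (r ^ 2 * ℓ) with h | h
      · rw [hG]
        simp only
        rw [eq_sqrt hα h]
        exact Real.sqrt_le_sqrt (by linarith)
      · refine (le_sqrt hα h).trans (Real.sqrt_le_sqrt ?_)
        nlinarith [sq_nonneg r]
    have h0 : 0 < G 0 := by
      refine lt_of_lt_of_le ?_ (sqrt_le hα)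
      simp
    obtain ⟨a, ha, hGa⟩ := intermediate_value_Icc (f := fun a => a * t - G a) hr0.le
      (by fun_prop) (show (0 : ℝ) ∈ Set.Icc _ _ from ⟨by simpa using h0.le, by linarith⟩)
    refine ⟨a, lt_of_le_of_ne ha.1 ?_, by simp only at hGa; linarith⟩
    rintro rfl
    simp only [zero_mul, zero_sub, neg_eq_zero] at hGa
    exact h0.ne' hGa
  obtain ⟨a, ha, hGa⟩ := hex
  refine ⟨a, ⟨ha, hGa⟩, fun c ⟨hc0, hGc⟩ => hanti.injOn hc0 ha ?_⟩
  rw [← hGa, show G c = c * t from hGc.symm]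
  field_simp

end smoothedProfile

/-! ### Cauchy-Schwarz for the fundamental tensor, from positivity in all directions. -/

/-- The Cauchy-Schwarz inequality for the second derivative of a two-homogeneous function `L` at
`w`: here `ℓ(t) = L(w + t u)`, and `m_λ(t) = L(w + t (u + λ w))`. -/
theorem sq_le_of_homogeneous {ℓ : ℝ → ℝ} {m : ℝ → ℝ → ℝ} {l₁ l₂ : ℝ}
    (hl : HasTwoDerivsAt ℓ l₁ l₂ 0) (h0 : 0 < ℓ 0)
    (hm : ∀ c, ∀ᶠ t in 𝓝 (0 : ℝ), m c t = (1 + c * t) ^ 2 * ℓ (t / (1 + c * t)))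
    (hpos : ∀ c, 0 ≤ deriv (deriv (m c)) 0) : l₁ ^ 2 ≤ 2 * ℓ 0 * l₂ := by
  -- Homogeneity turns the second derivative in direction `u + c w` into a quadratic in `c`, with
  -- coefficients `ℓ 0`, `l₁`, `l₂`. No bilinearity of the tensor is needed.
  have key : ∀ c, 0 ≤ 2 * c ^ 2 * ℓ 0 + 2 * c * l₁ + l₂ := by
    intro c
    have hq : HasTwoDerivsAt (fun t => t / (1 + c * t)) 1 (-2 * c) 0 := by
      refine ⟨fun t => 1 / (1 + c * t) ^ 2, ?_, by simp, ?_⟩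
      · have : ContinuousAt (fun t : ℝ => 1 + c * t) 0 := by fun_prop
        filter_upwards [this.eventually_ne (show 1 + c * 0 ≠ 0 by simp)] with t ht
        refine ((hasDerivAt_id' t).fun_div
          (((hasDerivAt_id' t).const_mul c).const_add 1) ht).congr_deriv ?_
        field_simp
        ring
      · have := ((((hasDerivAt_id' (0 : ℝ)).const_mul c).const_add 1).fun_pow 2).fun_inv
          (by simp)
        simp only [one_div]
        refine this.congr_deriv ?_
        simp
    have hp : HasTwoDerivsAt (fun t => (1 + c * t) ^ 2) (2 * c) (2 * c ^ 2) 0 := by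
      have h1 := (HasTwoDerivsAt.const (a := 0) 1).add
        ((HasTwoDerivsAt.const c).mul HasTwoDerivsAt.id)
      refine ((h1.mul h1).congr_of_eventuallyEq (.of_forall fun t => by ring)).congr_derivs ?_ ?_
      · ring
      · ring
    have hl' : HasTwoDerivsAt ℓ l₁ l₂ ((fun t => t / (1 + c * t)) 0) := by simpa using hl
    have hmm := ((hp.mul (HasTwoDerivsAt.comp (g := fun t => t / (1 + c * t)) hl' hq)).congr_of_eventuallyEq (hm c)).deriv_deriv
    have := hpos c
    rw [hmm] at this
    simp only [mul_zero, add_zero, zero_div] at this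
    linarith
  -- The minimizer of the quadratic.
  have := key (-l₁ / (2 * ℓ 0))
  have h2 : 2 * (-l₁ / (2 * ℓ 0)) ^ 2 * ℓ 0 + 2 * (-l₁ / (2 * ℓ 0)) * l₁ + l₂
      = (2 * ℓ 0 * l₂ - l₁ ^ 2) / (2 * ℓ 0) := by
    field_simp
    ring
  rw [h2, le_div_iff₀ (by positivity)] at this
  linarith

/-! ### The form, the projection and the Finsler metric on `TM`. -/

namespace ConeTriple

variable {n : ℕ} {M : Type*} [TopologicalSpace M] [ChartedSpace (EuclideanSpace ℝ (Fin n)) M]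
  [IsManifold (𝓡 n) ∞ M] {k : ℕ∞} (c : ConeTriple n M k)

theorem contMDiff_form : ContMDiff (𝓡 n).tangent 𝓘(ℝ, ℝ) k c.form := by
  intro v
  have h1 : ContMDiffAt (𝓡 n).tangent ((𝓡 n).prod 𝓘(ℝ, EuclideanSpace ℝ (Fin n) →L[ℝ] ℝ)) k
      (fun m : TangentBundle (𝓡 n) M => TotalSpace.mk' (EuclideanSpace ℝ (Fin n) →L[ℝ] ℝ)
        (E := fun p : M => TangentSpace (𝓡 n) p →L[ℝ] Bundle.Trivial M ℝ p) m.proj (c.Ω m.proj)) v :=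
    (c.Ω.contMDiff v.proj).comp v (contMDiffAt_proj _)
  have h2 : ContMDiffAt (𝓡 n).tangent (𝓡 n).tangent k
      (fun m : TangentBundle (𝓡 n) M => TotalSpace.mk' (EuclideanSpace ℝ (Fin n))
        (E := fun p : M => TangentSpace (𝓡 n) p) m.proj m.snd) v := contMDiffAt_id
  have h3 := ContMDiffAt.clm_bundle_apply h1 h2
  rw [contMDiffAt_totalSpace] at h3
  exact h3.2

/-- The projection onto `ker Ω` along `T` in a tangent space. -/
def projFibre (p : M) : TangentSpace (𝓡 n) p →ₗ[ℝ] TangentSpace (𝓡 n) p where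
  toFun v := v - c.form ⟨p, v⟩ • c.T p
  map_add' v w := by
    have : c.form ⟨p, v + w⟩ = c.form ⟨p, v⟩ + c.form ⟨p, w⟩ := (c.Ω p).map_add v w
    rw [this]; module
  map_smul' a v := by
    have : c.form ⟨p, a • v⟩ = a * c.form ⟨p, v⟩ := (c.Ω p).map_smul a v
    rw [this, RingHom.id_apply]; module

theorem form_add_smul (p : M) (v u : TangentSpace (𝓡 n) p) (t : ℝ) :
    c.form ⟨p, v + t • u⟩ = c.form ⟨p, v⟩ + t * c.form ⟨p, u⟩ := by
  unfold form
  rw [show (c.Ω p) (v + t • u) = c.Ω p v + c.Ω p (t • u) from (c.Ω p).map_add _ _,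
    show (c.Ω p) (t • u) = t • c.Ω p u from (c.Ω p).map_smul _ _]
  rfl

theorem form_smul (p : M) (v : TangentSpace (𝓡 n) p) (t : ℝ) :
    c.form ⟨p, t • v⟩ = t * c.form ⟨p, v⟩ := (c.Ω p).map_smul t v

theorem form_field (p : M) : c.form ⟨p, c.T p⟩ = 1 := c.Ω_T p

theorem form_projFibre (p : M) (v : TangentSpace (𝓡 n) p) : c.form ⟨p, c.projFibre p v⟩ = 0 := by
  have : c.projFibre p v = v + (-c.form ⟨p, v⟩) • c.T p := by
    change v - c.form ⟨p, v⟩ • c.T p = _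
    module
  rw [this, form_add_smul, form_field]
  ring

theorem projFibre_field (p : M) : c.projFibre p (c.T p) = 0 := by
  change c.T p - c.form ⟨p, c.T p⟩ • c.T p = 0
  rw [form_field, one_smul, sub_self]

theorem projFibre_of_form_eq_zero {p : M} {v : TangentSpace (𝓡 n) p} (h : c.form ⟨p, v⟩ = 0) :
    c.projFibre p v = v := by
  change v - c.form ⟨p, v⟩ • c.T p = v
  rw [h, zero_smul, sub_zero]

theorem contMDiff_projection : ContMDiff (𝓡 n).tangent (𝓡 n).tangent k c.proj := by
  intro v
  let e := trivializationAt (EuclideanSpace ℝ (Fin n)) (TangentSpace (𝓡 n) : M → Type _) v.proj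
  have hid : ContMDiffAt (𝓡 n).tangent 𝓘(ℝ, EuclideanSpace ℝ (Fin n)) k
      (fun w : TangentBundle (𝓡 n) M => (e w).2) v :=
    (contMDiffAt_totalSpace.1 (contMDiffAt_id (I := (𝓡 n).tangent) (x := v))).2
  have hT : ContMDiffAt (𝓡 n).tangent 𝓘(ℝ, EuclideanSpace ℝ (Fin n)) k
      (fun w : TangentBundle (𝓡 n) M => (e ⟨w.proj, c.T w.proj⟩).2) v :=
    (contMDiffAt_totalSpace.1 ((c.T.contMDiff v.proj).comp v (contMDiffAt_proj _))).2
  rw [contMDiffAt_totalSpace]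
  refine ⟨contMDiffAt_proj _, ?_⟩
  refine (hid.sub ((c.contMDiff_form v).smul hT)).congr_of_eventuallyEq ?_
  have hb : ∀ᶠ w : TangentBundle (𝓡 n) M in 𝓝 v, w.proj ∈ e.baseSet :=
    (FiberBundle.continuous_proj _ _).continuousAt.eventually
      (e.open_baseSet.mem_nhds (mem_baseSet_trivializationAt _ _ _))
  filter_upwards [hb] with w hw
  have hl := e.linear ℝ hw
  change (e ⟨w.proj, w.snd - c.form w • c.T w.proj⟩).2 = _
  rw [hl.map_sub, hl.map_smul]
  rfl

/-- The Finsler metric, extended to `TM` by the projection onto `ker Ω`. -/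
def finsler (v : TangentBundle (𝓡 n) M) : ℝ := c.F (c.proj v)

theorem finsler_mk (p : M) (v : TangentSpace (𝓡 n) p) :
    c.finsler ⟨p, v⟩ = c.F ⟨p, c.projFibre p v⟩ := rfl

theorem finsler_pos {p : M} {v : TangentSpace (𝓡 n) p} (h : c.projFibre p v ≠ 0) :
    0 < c.finsler ⟨p, v⟩ :=
  c.F_pos p _ (c.form_projFibre p v) h

theorem finsler_eq_zero {p : M} {v : TangentSpace (𝓡 n) p} (h : c.projFibre p v = 0) :
    c.finsler ⟨p, v⟩ = 0 := by
  rw [finsler_mk, h, c.F_zero]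

theorem finsler_nonneg (v : TangentBundle (𝓡 n) M) : 0 ≤ c.finsler v := by
  obtain ⟨p, v⟩ := v
  by_cases h : c.projFibre p v = 0
  · exact (c.finsler_eq_zero h).ge
  · exact (c.finsler_pos h).le

theorem finsler_smul (p : M) (v : TangentSpace (𝓡 n) p) {a : ℝ} (ha : 0 < a) :
    c.finsler ⟨p, a • v⟩ = a * c.finsler ⟨p, v⟩ := by
  rw [finsler_mk, map_smul, c.F_smul p _ a (c.form_projFibre p v) ha]
  rfl

theorem finsler_add_smul_field (p : M) (v : TangentSpace (𝓡 n) p) (t : ℝ) :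
    c.finsler ⟨p, v + t • c.T p⟩ = c.finsler ⟨p, v⟩ := by
  rw [finsler_mk, map_add, map_smul, projFibre_field, smul_zero, add_zero]
  rfl

/-- `F` is only assumed smooth on the nonzero vectors of `ker Ω`, a set that need not be open in
`TM`. Composing with the projection gives a function on an open set, so smoothness on a set becomes
smoothness at a point. -/
theorem contMDiffAt_finsler {v : TangentBundle (𝓡 n) M} (h : c.projFibre v.proj v.snd ≠ 0) :
    ContMDiffAt (𝓡 n).tangent 𝓘(ℝ, ℝ) k c.finsler v := by
  have hopen : ∀ᶠ w in 𝓝 v, (c.proj w).snd ≠ 0 := by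
    let e := trivializationAt (EuclideanSpace ℝ (Fin n)) (TangentSpace (𝓡 n) : M → Type _) v.proj
    have h1 : ContinuousAt (fun w => (e (c.proj w)).2) v :=
      (contMDiffAt_totalSpace.1 (c.contMDiff_projection v)).2.continuousAt
    have hb : ∀ᶠ w : TangentBundle (𝓡 n) M in 𝓝 v, w.proj ∈ e.baseSet :=
      (FiberBundle.continuous_proj _ _).continuousAt.eventually
        (e.open_baseSet.mem_nhds (mem_baseSet_trivializationAt _ _ _))
    have h2 : (e (c.proj v)).2 ≠ 0 := by
      have hv : v.proj ∈ e.baseSet := mem_baseSet_trivializationAt _ _ _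
      intro h0
      exact h ((e.continuousLinearEquivAt ℝ v.proj hv).map_eq_zero_iff.1 h0)
    filter_upwards [h1.eventually_ne h2, hb] with w hw hb h0
    apply hw
    change (e ⟨w.proj, (c.proj w).snd⟩).2 = 0
    rw [h0]
    exact (e.linear ℝ hb).map_zero
  have := (c.F_contMDiffOn.comp (s := {w | (c.proj w).snd ≠ 0}) c.contMDiff_projection.contMDiffOn
    fun w hw => ⟨c.form_projFibre w.proj w.snd, hw⟩)
  exact this.contMDiffAt hopen

/-- In a trivialization of `TM`, a Finsler metric is locally uniformly equivalent to the
Euclidean norm. -/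
theorem exists_finsler_bounds (p₀ : M) : ∃ a b : ℝ, 0 < a ∧ 0 < b ∧ ∀ᶠ p in 𝓝 p₀,
    ∀ w : TangentSpace (𝓡 n) p, c.form ⟨p, w⟩ = 0 →
      a * ‖(trivializationAt (EuclideanSpace ℝ (Fin n)) (TangentSpace (𝓡 n)) p₀ ⟨p, w⟩).2‖
        ≤ c.F ⟨p, w⟩ ∧
      c.F ⟨p, w⟩ ≤
        b * ‖(trivializationAt (EuclideanSpace ℝ (Fin n)) (TangentSpace (𝓡 n)) p₀ ⟨p, w⟩).2‖ := by
  set e := trivializationAt (EuclideanSpace ℝ (Fin n)) (TangentSpace (𝓡 n) : M → Type _) p₀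
  have hp₀ : p₀ ∈ e.baseSet := mem_baseSet_trivializationAt _ _ _
  have key : ∃ N : ℝ, 0 < N ∧ ∀ᶠ p in 𝓝 p₀, ∀ u ∈ Metric.sphere (0 : EuclideanSpace ℝ (Fin n)) 1,
      c.form (e.toOpenPartialHomeomorph.symm (p, u)) = 0 →
      N⁻¹ < c.finsler (e.toOpenPartialHomeomorph.symm (p, u)) ∧
        c.finsler (e.toOpenPartialHomeomorph.symm (p, u)) < N := by
    have hcomp := isCompact_sphere (0 : EuclideanSpace ℝ (Fin n)) 1
    -- The bounds are proved on the unit sphere of the trivialization by compactness; `P` weakens as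
    -- `N` grows, so finitely many local constants have a common one.
    let P : ℝ → M → EuclideanSpace ℝ (Fin n) → Prop := fun N p u =>
      c.form (e.toOpenPartialHomeomorph.symm (p, u)) = 0 →
      N⁻¹ < c.finsler (e.toOpenPartialHomeomorph.symm (p, u)) ∧
        c.finsler (e.toOpenPartialHomeomorph.symm (p, u)) < N
    have hmono : ∀ {N N' : ℝ}, 0 < N → N ≤ N' → ∀ p u, P N p u → P N' p u :=
      fun h0 h p u hP h1 => ⟨(inv_anti₀ h0 h).trans_lt (hP h1).1, (hP h1).2.trans_le h⟩
    have hloc : ∀ u ∈ Metric.sphere (0 : EuclideanSpace ℝ (Fin n)) 1,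
        ∃ N, 0 < N ∧ ∀ᶠ q : M × EuclideanSpace ℝ (Fin n) in 𝓝 (p₀, u), P N q.1 q.2 := by
      intro u hu
      have htgt : (p₀, u) ∈ e.target := by rw [e.mem_target]; exact hp₀
      have hcont : ContinuousAt e.toOpenPartialHomeomorph.symm (p₀, u) :=
        e.toOpenPartialHomeomorph.symm.continuousAt htgt
      set v := e.toOpenPartialHomeomorph.symm (p₀, u)
      by_cases hf : c.form v = 0
      · have hvp : c.projFibre v.proj v.snd = v.snd := c.projFibre_of_form_eq_zero hf
        have hne : c.projFibre v.proj v.snd ≠ 0 := by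
          rw [hvp]
          intro h0
          have h1 : e v = (p₀, u) := e.toOpenPartialHomeomorph.right_inv htgt
          have h2 : v.proj = p₀ := e.proj_symm_apply htgt
          have h3 : (e ⟨v.proj, v.snd⟩).2 = u := congrArg Prod.snd h1
          rw [h0, (e.linear ℝ (by rw [h2]; exact hp₀)).map_zero] at h3
          rw [← h3] at hu
          simp at hu
        have hF := (c.contMDiffAt_finsler hne).continuousAt
        have hpos : 0 < c.finsler v := c.finsler_pos hne
        refine ⟨2 * (c.finsler v + (c.finsler v)⁻¹), by positivity, ?_⟩
        have hFc : ContinuousAt (fun q => c.finsler (e.toOpenPartialHomeomorph.symm q)) (p₀, u) :=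
          ContinuousAt.comp (g := c.finsler) (f := e.toOpenPartialHomeomorph.symm) hF hcont
        have e1 : (2 * (c.finsler v + (c.finsler v)⁻¹))⁻¹ < c.finsler v := by
          rw [inv_lt_iff_one_lt_mul₀ (by positivity)]
          field_simp
          nlinarith [sq_nonneg (c.finsler v)]
        have e2 : c.finsler v < 2 * (c.finsler v + (c.finsler v)⁻¹) := by
          have : 0 < (c.finsler v)⁻¹ := by positivity
          linarith
        filter_upwards [hFc.eventually (lt_mem_nhds e1), hFc.eventually (gt_mem_nhds e2)]
          with q h1 h2 _
        exact ⟨h1, h2⟩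
      -- Off `ker Ω` the condition is vacuous nearby, so any constant works.
      · refine ⟨1, one_pos, ?_⟩
        have hform : ContinuousAt (fun q => c.form (e.toOpenPartialHomeomorph.symm q)) (p₀, u) :=
          (c.contMDiff_form.continuous.continuousAt).comp hcont
        filter_upwards [hform.eventually_ne hf] with q hq h0
        exact absurd h0 hq
    have : ∃ N, 0 < N ∧ ∀ᶠ q : M × EuclideanSpace ℝ (Fin n) in
        𝓝 p₀ ×ˢ 𝓝ˢ (Metric.sphere (0 : EuclideanSpace ℝ (Fin n)) 1), P N q.1 q.2 := by
      refine hcomp.induction_on (p := fun K => ∃ N, 0 < N ∧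
        ∀ᶠ q : M × EuclideanSpace ℝ (Fin n) in 𝓝 p₀ ×ˢ 𝓝ˢ K, P N q.1 q.2) ?_ ?_ ?_ ?_
      · exact ⟨1, one_pos, by simp⟩
      · rintro s t hst ⟨N, h0, h⟩
        exact ⟨N, h0, h.filter_mono (Filter.prod_mono le_rfl (nhdsSet_mono hst))⟩
      · rintro s t ⟨N, h0, h⟩ ⟨N', h0', h'⟩
        refine ⟨max N N', lt_max_of_lt_left h0, ?_⟩
        rw [nhdsSet_union, Filter.prod_sup]
        exact Filter.eventually_sup.2 ⟨h.mono fun q => hmono h0 (le_max_left _ _) _ _,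
          h'.mono fun q => hmono h0' (le_max_right _ _) _ _⟩
      · intro u hu
        obtain ⟨N, h0, h⟩ := hloc u hu
        rw [nhds_prod_eq] at h
        obtain ⟨s, hs, t, ht, hst⟩ := Filter.eventually_prod_iff.1 h
        obtain ⟨o, ho, hoo, huo⟩ := mem_nhds_iff.1 ht
        refine ⟨o, mem_nhdsWithin_of_mem_nhds (hoo.mem_nhds huo), N, h0, ?_⟩
        refine Filter.eventually_prod_iff.2 ⟨s, hs, (· ∈ o), ?_, fun hx y hy => hst hx (ho hy)⟩
        exact hoo.mem_nhdsSet.2 subset_rfl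
    obtain ⟨N, h0, h⟩ := this
    refine ⟨N, h0, ?_⟩
    obtain ⟨s, hs, t, ht, hst⟩ := Filter.eventually_prod_iff.1 h
    filter_upwards [hs] with p hp u hu
    exact hst hp (ht.self_of_nhdsSet u hu)
  obtain ⟨N, hN, h⟩ := key
  refine ⟨N⁻¹, N, inv_pos.2 hN, hN, ?_⟩
  filter_upwards [h, e.open_baseSet.mem_nhds hp₀] with p hp hb w hw
  have hl := e.linear ℝ hb
  by_cases hw0 : w = 0
  · subst hw0
    rw [hl.map_zero, c.F_zero]
    simp
  set x := (e ⟨p, w⟩).2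
  have hx0 : x ≠ 0 := fun h0 =>
    hw0 ((e.continuousLinearEquivAt ℝ p hb).map_eq_zero_iff.1 h0)
  have hxn : 0 < ‖x‖ := norm_pos_iff.2 hx0
  have hsymm : e.toOpenPartialHomeomorph.symm (p, ‖x‖⁻¹ • x) = ⟨p, ‖x‖⁻¹ • w⟩ := by
    rw [← hl.map_smul]
    exact e.symm_apply_mk_proj (x := (⟨p, ‖x‖⁻¹ • w⟩ : TangentBundle (𝓡 n) M)) hb
  have hu : ‖x‖⁻¹ • x ∈ Metric.sphere (0 : EuclideanSpace ℝ (Fin n)) 1 := by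
    rw [mem_sphere_zero_iff_norm, norm_smul, norm_inv, norm_norm, inv_mul_cancel₀ hxn.ne']
  have := hp _ hu
  rw [hsymm, form_smul, hw, mul_zero, c.finsler_smul p w (inv_pos.2 hxn)] at this
  obtain ⟨h1, h2⟩ := this rfl
  rw [finsler_mk, c.projFibre_of_form_eq_zero hw] at h1 h2
  rw [inv_mul_eq_div] at h1 h2
  rw [lt_div_iff₀ hxn] at h1
  rw [div_lt_iff₀ hxn] at h2
  exact ⟨h1.le, h2.le⟩

/-- Where the projection vanishes, `F` is squeezed by a multiple of the Euclidean norm of the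
projection. Continuity there is what lets the strict inequality that defines the slope-one regime of
the ramp spread to a neighbourhood. -/
theorem continuous_finsler : Continuous c.finsler := by
  rw [continuous_iff_continuousAt]
  rintro v
  by_cases h : c.projFibre v.proj v.snd = 0
  swap
  · exact (c.contMDiffAt_finsler h).continuousAt
  obtain ⟨a, b, -, -, hab⟩ := c.exists_finsler_bounds v.proj
  let e := trivializationAt (EuclideanSpace ℝ (Fin n)) (TangentSpace (𝓡 n) : M → Type _) v.proj
  have h1 : ContinuousAt (fun w => (e (c.proj w)).2) v :=
    (contMDiffAt_totalSpace.1 (c.contMDiff_projection v)).2.continuousAt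
  have h0 : c.finsler v = 0 := c.finsler_eq_zero h
  have h2 : (e (c.proj v)).2 = 0 := by
    rw [show c.proj v = ⟨v.proj, 0⟩ from congrArg (TotalSpace.mk v.proj) h]
    exact (e.linear ℝ (mem_baseSet_trivializationAt _ _ _)).map_zero
  have h3 : Filter.Tendsto (fun w => b * ‖(e (c.proj w)).2‖) (𝓝 v) (𝓝 0) := by
    have := (h1.norm.const_mul b)
    rw [ContinuousAt] at this
    simpa [h2] using this
  rw [ContinuousAt, h0]
  refine squeeze_zero' (.of_forall c.finsler_nonneg) ?_ h3
  filter_upwards [(FiberBundle.continuous_proj (EuclideanSpace ℝ (Fin n))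
    (TangentSpace (𝓡 n) : M → Type _)).continuousAt.eventually hab] with w hw
  exact (hw _ (c.form_projFibre w.proj w.snd)).2

end ConeTriple

/-! ### The auxiliary data: a small Riemannian metric and a small function. -/

theorem LinearMap.BilinForm.finsum_smul_apply {V ι : Type*} [AddCommGroup V] [Module ℝ V]
    {w : ι → ℝ} (hw : (Function.support w).Finite) (D : ι → LinearMap.BilinForm ℝ V) (v : V) :
    (∑ᶠ i, w i • D i) v v = ∑ᶠ i, w i • D i v v := by
  have hs : Function.support (fun i => w i • D i) ⊆ hw.toFinset := fun i hi => by
    rw [hw.coe_toFinset]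
    exact left_ne_zero_of_smul (Function.mem_support.1 hi)
  have hs' : Function.support (fun i => w i • D i v v) ⊆ hw.toFinset := fun i hi => by
    rw [hw.coe_toFinset]
    exact left_ne_zero_of_smul (Function.mem_support.1 hi)
  rw [finsum_eq_sum_of_support_subset _ hs, finsum_eq_sum_of_support_subset _ hs']
  simp [LinearMap.sum_apply]

/-- Weighted averages of positive definite bilinear forms bounded by a function. -/
theorem LinearMap.BilinForm.finsum_pos_and_le {V ι : Type*} [AddCommGroup V] [Module ℝ V]
    {w : ι → ℝ} (hw : (Function.support w).Finite) (D : ι → LinearMap.BilinForm ℝ V)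
    {K : Set V} {N : V → ℝ} (h0 : ∀ i, 0 ≤ w i) (h1 : ∑ᶠ i, w i = 1)
    (hD : ∀ i, w i ≠ 0 → (∀ v, v ≠ 0 → 0 < D i v v) ∧ ∀ v, v ∈ K → 4 * D i v v ≤ N v) :
    (∀ v, v ≠ 0 → 0 < (∑ᶠ i, w i • D i) v v) ∧
      ∀ v, v ∈ K → 4 * (∑ᶠ i, w i • D i) v v ≤ N v := by
  refine ⟨fun v hv => ?_, fun v hv => ?_⟩
  · rw [LinearMap.BilinForm.finsum_smul_apply hw]
    exact (convex_Ioi (0 : ℝ)).finsum_mem h0 h1 fun i hi => (hD i hi).1 v hv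
  · rw [LinearMap.BilinForm.finsum_smul_apply hw]
    have : ∑ᶠ i, w i • D i v v ∈ Set.Iic (N v / 4) :=
      (convex_Iic (N v / 4)).finsum_mem h0 h1 fun i hi => by
        have := (hD i hi).2 v hv
        rw [Set.mem_Iic]
        linarith
    rw [Set.mem_Iic] at this
    linarith

namespace ConeTriple

variable {n : ℕ} {M : Type*} [TopologicalSpace M] [ChartedSpace (EuclideanSpace ℝ (Fin n)) M]
  [IsManifold (𝓡 n) ∞ M] {k : ℕ∞} (c : ConeTriple n M k)

/-- There is a Riemannian metric on `M` which is bounded by `F / 2` on `ker Ω`. -/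
theorem exists_riemannian_le [T2Space M] [SecondCountableTopology M] :
    ∃ B : ∀ p : M, LinearMap.BilinForm ℝ (TangentSpace (𝓡 n) p),
      ContMDiff (𝓡 n).tangent 𝓘(ℝ, ℝ) ∞
        (fun v : TangentBundle (𝓡 n) M => B v.proj v.snd v.snd) ∧
      ∀ p, (∀ v, v ≠ 0 → 0 < B p v v) ∧
        ∀ v, c.form ⟨p, v⟩ = 0 → 4 * B p v v ≤ c.F ⟨p, v⟩ ^ 2 := by
  have : LocallyCompactSpace M := ChartedSpace.locallyCompactSpace (EuclideanSpace ℝ (Fin n)) M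
  choose a b ha hb hab using c.exists_finsler_bounds
  let e : ∀ p₀ : M, Trivialization (EuclideanSpace ℝ (Fin n))
      (TotalSpace.proj : TangentBundle (𝓡 n) M → M) :=
    fun p₀ => trivializationAt (EuclideanSpace ℝ (Fin n)) (TangentSpace (𝓡 n) : M → Type _) p₀
  choose O hOs hOo hOm using fun p₀ => mem_nhds_iff.1
    (Filter.inter_mem (hab p₀) ((e p₀).open_baseSet.mem_nhds (mem_baseSet_trivializationAt _ _ p₀)))
  obtain ⟨ρ, hρ⟩ := SmoothPartitionOfUnity.exists_isSubordinate (𝓡 n) isClosed_univ O hOo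
    fun x _ => Set.mem_iUnion.2 ⟨x, hOm x⟩
  -- Locally `a ‖·‖ ≤ F` on `ker Ω`, so `a²/4` times the Euclidean metric is admissible; the
  -- conditions are convex and survive averaging by a partition of unity.
  let D : ∀ (i p : M), LinearMap.BilinForm ℝ (TangentSpace (𝓡 n) p) := fun i p =>
    ((a i) ^ 2 / 4) • (innerₗ (EuclideanSpace ℝ (Fin n))).compl₁₂
      ((e i).linearMapAt ℝ p) ((e i).linearMapAt ℝ p)
  have hD : ∀ i p, p ∈ (e i).baseSet → ∀ v : TangentSpace (𝓡 n) p,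
      D i p v v = (a i) ^ 2 / 4 * ‖(e i ⟨p, v⟩).2‖ ^ 2 := by
    intro i p hp v
    have : (e i).linearMapAt ℝ p v = (e i ⟨p, v⟩).2 := (e i).linearMapAt_apply (R := ℝ) v |>.trans
      (if_pos hp)
    simp only [D, LinearMap.smul_apply, LinearMap.compl₁₂_apply, innerₗ_apply_apply, smul_eq_mul]
    rw [this, real_inner_self_eq_norm_sq]
  refine ⟨fun p => ∑ᶠ i, ρ i p • D i p, ?_, fun p => ?_⟩
  · have hfin : ∀ v : TangentBundle (𝓡 n) M, (∑ᶠ i, ρ i v.proj • D i v.proj) v.snd v.snd =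
        ∑ᶠ i, ρ i v.proj * D i v.proj v.snd v.snd := by
      intro v
      exact LinearMap.BilinForm.finsum_smul_apply (ρ.locallyFinite.point_finite v.proj)
        (fun i => D i v.proj) v.snd
    simp_rw [hfin]
    refine contMDiff_finsum (fun i v => ?_) ?_
    · by_cases hv : v.proj ∈ tsupport (ρ i)
      · have hvb : v.proj ∈ (e i).baseSet := (hOs i (hρ i hv)).2
        have h1 : ContMDiffAt (𝓡 n).tangent 𝓘(ℝ, EuclideanSpace ℝ (Fin n)) ∞
            (fun w : TangentBundle (𝓡 n) M => (e i w).2) v :=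
          ((e i).contMDiffAt_iff (f := fun w : TangentBundle (𝓡 n) M => w)
            ((e i).mem_source.2 hvb)).1 contMDiffAt_id |>.2
        have h2 : ContMDiffAt (𝓡 n).tangent 𝓘(ℝ, ℝ) ∞
            (fun w : TangentBundle (𝓡 n) M => ‖(e i w).2‖ ^ 2) v :=
          ((contDiff_norm_sq ℝ).contMDiff _).comp v h1
        have h3 : ContMDiffAt (𝓡 n).tangent 𝓘(ℝ, ℝ) ∞
            (fun w : TangentBundle (𝓡 n) M => ρ i w.proj) v :=
          ((ρ i).contMDiff _).comp v (contMDiffAt_proj _)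
        have h4 : ContMDiffAt (𝓡 n).tangent 𝓘(ℝ, ℝ) ∞
            (fun w : TangentBundle (𝓡 n) M => ρ i w.proj * ((a i) ^ 2 / 4 * ‖(e i w).2‖ ^ 2)) v :=
          h3.mul (contMDiffAt_const.mul h2)
        refine h4.congr_of_eventuallyEq ?_
        filter_upwards [(FiberBundle.continuous_proj (EuclideanSpace ℝ (Fin n))
          (TangentSpace (𝓡 n) : M → Type _)).continuousAt.eventually
            ((e i).open_baseSet.mem_nhds hvb)] with w hw
        rw [hD i w.proj hw]
      · refine (contMDiffAt_const (c := (0 : ℝ))).congr_of_eventuallyEq ?_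
        have hc : ∀ᶠ p in 𝓝 v.proj, p ∉ tsupport (ρ i) :=
          (isClosed_tsupport (ρ i)).isOpen_compl.mem_nhds hv
        have hc' : ∀ᶠ w : TangentBundle (𝓡 n) M in 𝓝 v, w.proj ∉ tsupport (ρ i) :=
          (FiberBundle.continuous_proj (EuclideanSpace ℝ (Fin n))
            (TangentSpace (𝓡 n) : M → Type _)).continuousAt.eventually hc
        filter_upwards [hc'] with w hw
        rw [image_eq_zero_of_notMem_tsupport hw, zero_mul]
    · have hlf : LocallyFinite fun i => {v : TangentBundle (𝓡 n) M | ρ i v.proj ≠ 0} :=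
        ρ.locallyFinite.preimage_continuous (FiberBundle.continuous_proj
          (EuclideanSpace ℝ (Fin n)) (TangentSpace (𝓡 n) : M → Type _))
      refine hlf.subset fun i v hv h0 => hv ?_
      change ρ i v.proj * D i v.proj v.snd v.snd = 0
      rw [h0, zero_mul]
  · refine LinearMap.BilinForm.finsum_pos_and_le (w := fun i => ρ i p)
      (ρ.locallyFinite.point_finite p) (fun i => D i p)
      (K := {v | c.form ⟨p, v⟩ = 0}) (N := fun v => c.F ⟨p, v⟩ ^ 2) (ρ.nonneg · p)
      (ρ.sum_eq_one (Set.mem_univ p)) fun i hi => ?_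
    obtain ⟨hbd, hpb⟩ := hOs i (hρ i (subset_tsupport _ hi))
    refine ⟨fun v hv => ?_, fun v hv => ?_⟩
    · rw [hD i p hpb]
      have : (e i ⟨p, v⟩).2 ≠ 0 := fun h0 =>
        hv (((e i).continuousLinearEquivAt ℝ p hpb).map_eq_zero_iff.1 h0)
      have := norm_pos_iff.2 this
      have := ha i
      positivity
    · rw [hD i p hpb]
      have := (hbd v hv).1
      have h0 : 0 ≤ a i * ‖(e i ⟨p, v⟩).2‖ := mul_nonneg (ha i).le (norm_nonneg _)
      have := pow_le_pow_left₀ h0 this 2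
      rw [mul_pow] at this
      linarith

/-- The size of the region in which the indicatrix has to be modified can be controlled by a smooth
function on `M`. -/
theorem exists_smooth_size [T2Space M] [SecondCountableTopology M]
    {U : Set (TangentBundle (𝓡 n) M)} (hU : U ∈ 𝓝ˢ (Set.range c.field)) :
    ∃ α : C^k⟮𝓡 n, M; 𝓘(ℝ, ℝ), ℝ⟯, ∀ p, 0 < α p ∧ α p ≤ 1 ∧ ∀ v : TangentSpace (𝓡 n) p,
      c.finsler ⟨p, v⟩ ^ 2 ≤ 2 * α p → 1 ≤ c.form ⟨p, v⟩ → c.form ⟨p, v⟩ ≤ √(1 + 2 * α p) →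
      (⟨p, v⟩ : TangentBundle (𝓡 n) M) ∈ U := by
  have : LocallyCompactSpace M := ChartedSpace.locallyCompactSpace (EuclideanSpace ℝ (Fin n)) M
  let t : M → Set ℝ := fun p => {a | 0 < a ∧ a ≤ 1 ∧ ∀ v : TangentSpace (𝓡 n) p,
    c.finsler ⟨p, v⟩ ^ 2 ≤ 2 * a → 1 ≤ c.form ⟨p, v⟩ → c.form ⟨p, v⟩ ≤ √(1 + 2 * a) →
      (⟨p, v⟩ : TangentBundle (𝓡 n) M) ∈ U}
  refine exists_contMDiffMap_forall_mem_convex_of_local_const (𝓡 n) (t := t) (fun p => ?_)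
    fun p₀ => ?_
  -- An admissible size stays admissible when decreased, so the admissible sizes form an interval
  -- and local constants can be glued.
  · refine Set.OrdConnected.convex ⟨?_⟩
    rintro x ⟨hx, -, -⟩ y ⟨-, hy, hy'⟩ z ⟨hxz, hzy⟩
    refine ⟨hx.trans_le hxz, hzy.trans hy, fun v h1 h2 h3 => hy' v (by linarith) h2 (h3.trans ?_)⟩
    exact Real.sqrt_le_sqrt (by linarith)
  · obtain ⟨a, b, ha, -, hab⟩ := c.exists_finsler_bounds p₀
    set e := trivializationAt (EuclideanSpace ℝ (Fin n)) (TangentSpace (𝓡 n) : M → Type _) p₀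
    have hp₀ : p₀ ∈ e.baseSet := mem_baseSet_trivializationAt _ _ _
    set x₀ := (e ⟨p₀, c.T p₀⟩).2
    have htgt : (p₀, x₀) ∈ e.target := by rw [e.mem_target]; exact hp₀
    have hsymm : e.toOpenPartialHomeomorph.symm (p₀, x₀) = ⟨p₀, c.T p₀⟩ :=
      e.symm_apply_mk_proj (x := (⟨p₀, c.T p₀⟩ : TangentBundle (𝓡 n) M)) hp₀
    have hUn : U ∈ 𝓝 (e.toOpenPartialHomeomorph.symm (p₀, x₀)) := by
      rw [hsymm]
      exact mem_nhdsSet_iff_forall.1 hU _ ⟨p₀, rfl⟩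
    have hpre := (e.toOpenPartialHomeomorph.symm.continuousAt htgt).eventually hUn
    rw [nhds_prod_eq] at hpre
    obtain ⟨s, hs, u, hu, hsu⟩ := Filter.eventually_prod_iff.1 hpre
    obtain ⟨r, hr, hru⟩ := Metric.eventually_nhds_iff.1 hu
    have hT : ContinuousAt (fun p => (e ⟨p, c.T p⟩).2) p₀ :=
      (contMDiffAt_totalSpace.1 (c.T.contMDiff p₀)).2.continuousAt
    -- In the trivialization, `v - T` splits into `π v`, of norm at most `√(2z)/a`, and `(Ω(v) - 1)
    -- T`, of norm at most `z (‖x₀‖ + r)`. The other `r/2` is for the variation of `T` with the base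
    -- point.
    have hsmall : ∃ z : ℝ, 0 < z ∧ z ≤ 1 ∧ √(2 * z) / a + z * (‖x₀‖ + r) < r / 2 := by
      have hc : Filter.Tendsto (fun z : ℝ => √(2 * z) / a + z * (‖x₀‖ + r)) (𝓝[>] 0) (𝓝 0) := by
        have : Continuous (fun z : ℝ => √(2 * z) / a + z * (‖x₀‖ + r)) := by fun_prop
        have h := (this.tendsto 0).mono_left (nhdsWithin_le_nhds (s := Set.Ioi 0))
        simpa using h
      obtain ⟨z, h1, h2, h3⟩ := ((hc.eventually (gt_mem_nhds (half_pos hr))).and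
        ((eventually_mem_nhdsWithin).and
          (nhdsWithin_le_nhds (s := Set.Ioi 0) (Iic_mem_nhds (one_pos))))).exists
      exact ⟨z, h2, h3, h1⟩
    obtain ⟨z, hz, hz1, hzr⟩ := hsmall
    refine ⟨z, ?_⟩
    filter_upwards [hab, hs, e.open_baseSet.mem_nhds hp₀,
      hT.eventually (Metric.ball_mem_nhds _ (half_pos hr))] with p h1 h2 hpb h3
    refine ⟨hz, hz1, fun v hv1 hv2 hv3 => ?_⟩
    have hl := e.linear ℝ hpb
    rw [← e.symm_apply_mk_proj (x := (⟨p, v⟩ : TangentBundle (𝓡 n) M)) hpb]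
    refine hsu h2 (hru ?_)
    have hdec : (e ⟨p, v⟩).2 = (e ⟨p, c.projFibre p v⟩).2 + c.form ⟨p, v⟩ • (e ⟨p, c.T p⟩).2 := by
      rw [← hl.map_smul, ← hl.map_add]
      congr 4
      exact (sub_add_cancel v _).symm
    have hw := (h1 _ (c.form_projFibre p v)).1
    rw [← finsler_mk] at hw
    have hF : c.finsler ⟨p, v⟩ ≤ √(2 * z) := Real.le_sqrt_of_sq_le hv1
    have hw' : ‖(e ⟨p, c.projFibre p v⟩).2‖ ≤ √(2 * z) / a := by
      rw [le_div_iff₀ ha]; linarith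
    have hform : c.form ⟨p, v⟩ - 1 ≤ z := by
      have : √(1 + 2 * z) ≤ 1 + z := Real.sqrt_le_iff.2 ⟨by linarith, by nlinarith⟩
      linarith
    have hTn : ‖(e ⟨p, c.T p⟩).2‖ ≤ ‖x₀‖ + r := by
      have := norm_le_norm_add_norm_sub' (e ⟨p, c.T p⟩).2 x₀
      rw [dist_eq_norm] at h3
      linarith
    calc dist (e ⟨p, v⟩).2 x₀ ≤ dist (e ⟨p, v⟩).2 (e ⟨p, c.T p⟩).2 + dist (e ⟨p, c.T p⟩).2 x₀ :=
          dist_triangle _ _ _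
      _ < r := by
        have : (e ⟨p, v⟩).2 - (e ⟨p, c.T p⟩).2 =
            (e ⟨p, c.projFibre p v⟩).2 + (c.form ⟨p, v⟩ - 1) • (e ⟨p, c.T p⟩).2 := by
          rw [hdec]; module
        have h4 := norm_add_le (e ⟨p, c.projFibre p v⟩).2
          ((c.form ⟨p, v⟩ - 1) • (e ⟨p, c.T p⟩).2)
        rw [norm_smul, Real.norm_of_nonneg (by linarith)] at h4
        have h5 : (c.form ⟨p, v⟩ - 1) * ‖(e ⟨p, c.T p⟩).2‖ ≤ z * (‖x₀‖ + r) :=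
          mul_le_mul hform hTn (norm_nonneg _) hz.le
        rw [dist_eq_norm (e ⟨p, v⟩).2, this]
        linarith

end ConeTriple

/-! ### Smoothness and convexity of the graph function on `TM`. -/

theorem smoothedProfile.contDiffAt (k : ℕ∞) {q : ℝ × ℝ × ℝ} (h1 : 0 < q.1) (h2 : 0 ≤ q.2.1)
    (h3 : 0 ≤ q.2.2) :
    ContDiffAt ℝ k (fun q : ℝ × ℝ × ℝ => smoothedProfile q.1 q.2.1 q.2.2) q := by
  have hx : ContDiffAt ℝ k (fun q : ℝ × ℝ × ℝ => √(1 + q.1 + q.2.1)) q :=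
    ContDiffAt.sqrt (by fun_prop) (by positivity)
  have hy : ContDiffAt ℝ k (fun q : ℝ × ℝ × ℝ => √(1 + q.2.2)) q :=
    ContDiffAt.sqrt (by fun_prop) (by positivity)
  have ha : ContDiffAt ℝ k (fun q : ℝ × ℝ × ℝ => q.1 / 6) q := by fun_prop
  exact hy.add (ha.mul ((smoothRamp.contDiff k).contDiffAt.comp q
    ((hx.sub hy).div ha (by positivity))))

/-- On the diagonal the two parameters only enter through `r + s`, which reduces the definiteness
statements to one-variable calculus. -/
theorem secondLineDeriv_self {V : Type*} [AddCommGroup V] [Module ℝ V] (L : V → ℝ) (v u : V) :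
    secondLineDeriv L v u u = deriv (deriv fun t : ℝ => L (v + t • u)) 0 := by
  unfold secondLineDeriv
  congr 1
  funext r
  have : (fun s : ℝ => L (v + r • u + s • u)) = fun s => (fun t : ℝ => L (v + t • u)) (r + s) := by
    funext s
    simp only [add_smul, add_assoc]
  rw [this, deriv_comp_const_add (fun t : ℝ => L (v + t • u)), add_zero]

theorem LinearMap.BilinForm.self_nonneg_of_pos {V : Type*} [AddCommGroup V] [Module ℝ V]
    (B : LinearMap.BilinForm ℝ V) (hB : ∀ v, v ≠ 0 → 0 < B v v) (v : V) : 0 ≤ B v v := by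
  by_cases h : v = 0
  · simp [h]
  · exact (hB v h).le

theorem LinearMap.BilinForm.hasTwoDerivsAt_line {V : Type*} [AddCommGroup V] [Module ℝ V]
    (B : LinearMap.BilinForm ℝ V) (hB : ∀ v, v ≠ 0 → 0 < B v v) (v : V) {u : V} (hu : u ≠ 0) :
    ∃ d₁ d₂, HasTwoDerivsAt (fun t : ℝ => B (v + t • u) (v + t • u)) d₁ d₂ 0 ∧ 0 < d₂ ∧
      d₁ ^ 2 ≤ 2 * B v v * d₂ := by
  have hexp : ∀ t : ℝ, B (v + t • u) (v + t • u) =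
      B u u * (t * t) + (B v u + B u v) * t + B v v := by
    intro t
    simp only [map_add, map_smul, LinearMap.add_apply, LinearMap.smul_apply, smul_eq_mul]
    ring
  refine ⟨B v u + B u v, 2 * B u u, ?_, by have := hB u hu; positivity, ?_⟩
  · refine ((((HasTwoDerivsAt.const (B u u)).mul (HasTwoDerivsAt.id.mul HasTwoDerivsAt.id)).add
      ((HasTwoDerivsAt.const (B v u + B u v)).mul HasTwoDerivsAt.id)).add
      (HasTwoDerivsAt.const (B v v))).congr_of_eventuallyEq (.of_forall hexp) |>.congr_derivs ?_ ?_
    · ring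
    · ring
  · have := discrim_le_zero (a := B u u) (b := B v u + B u v) (c := B v v)
      fun t => by rw [← hexp]; exact B.self_nonneg_of_pos hB _
    unfold discrim at this
    linarith

theorem contMDiff_tangentLine {n : ℕ} {M : Type*} [TopologicalSpace M]
    [ChartedSpace (EuclideanSpace ℝ (Fin n)) M] [IsManifold (𝓡 n) ∞ M] (k : ℕ∞) (p : M)
    (v u : TangentSpace (𝓡 n) p) :
    ContMDiff 𝓘(ℝ, ℝ) (𝓡 n).tangent k
      (fun t : ℝ => (⟨p, v + t • u⟩ : TangentBundle (𝓡 n) M)) := by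
  intro t
  let e := trivializationAt (EuclideanSpace ℝ (Fin n)) (TangentSpace (𝓡 n) : M → Type _) p
  rw [contMDiffAt_totalSpace]
  refine ⟨contMDiffAt_const, ?_⟩
  have hl := e.linear ℝ (mem_baseSet_trivializationAt _ _ p)
  have : (fun t : ℝ => (e ⟨p, v + t • u⟩).2) = fun t => (e ⟨p, v⟩).2 + t • (e ⟨p, u⟩).2 := by
    funext t
    rw [← hl.map_smul, ← hl.map_add]
  change ContMDiffAt _ _ _ (fun t : ℝ => (e ⟨p, v + t • u⟩).2) t
  rw [this]
  apply ContDiffAt.contMDiffAt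
  fun_prop

namespace ConeTriple

variable {n : ℕ} {M : Type*} [TopologicalSpace M] [ChartedSpace (EuclideanSpace ℝ (Fin n)) M]
  [IsManifold (𝓡 n) ∞ M] {k : ℕ∞} (c : ConeTriple n M k)

theorem deriv_deriv_finsler_sq_pos {p : M} {w u : TangentSpace (𝓡 n) p}
    (hw : c.form ⟨p, w⟩ = 0) (hw0 : w ≠ 0) (hu : c.form ⟨p, u⟩ = 0) (hu0 : u ≠ 0) :
    0 < deriv (deriv fun t : ℝ => c.F ⟨p, w + t • u⟩ ^ 2) 0 := by
  have := c.F_posDef p w u hw hw0 hu hu0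
  unfold fundamentalTensor at this
  rw [secondLineDeriv_self] at this
  linarith

/-- Along a line of a tangent space, `F²` has positive second derivative and satisfies the
Cauchy-Schwarz inequality. -/
theorem hasTwoDerivsAt_finsler_sq (hk : 2 ≤ k) {p : M} {v u : TangentSpace (𝓡 n) p}
    (hv : c.projFibre p v ≠ 0) (hu : c.projFibre p u ≠ 0) :
    ∃ d₁ d₂, HasTwoDerivsAt (fun t : ℝ => c.finsler ⟨p, v + t • u⟩ ^ 2) d₁ d₂ 0 ∧ 0 < d₂ ∧
      d₁ ^ 2 ≤ 2 * c.finsler ⟨p, v⟩ ^ 2 * d₂ := by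
  have hC : ContDiffAt ℝ 2 (fun t : ℝ => c.finsler ⟨p, v + t • u⟩ ^ 2) 0 := by
    have h1 : ContMDiffAt (𝓡 n).tangent 𝓘(ℝ, ℝ) k c.finsler
        (⟨p, v + (0 : ℝ) • u⟩ : TangentBundle (𝓡 n) M) :=
      c.contMDiffAt_finsler (by simpa using hv)
    have h2 : ContMDiffAt 𝓘(ℝ, ℝ) 𝓘(ℝ, ℝ) k (fun t : ℝ => c.finsler ⟨p, v + t • u⟩) 0 :=
      ContMDiffAt.comp (g := c.finsler)
        (f := fun t : ℝ => (⟨p, v + t • u⟩ : TangentBundle (𝓡 n) M)) 0 h1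
        (contMDiff_tangentLine k p v u 0)
    exact (h2.contDiffAt.of_le (WithTop.coe_le_coe.2 hk)).pow 2
  have h2 := HasTwoDerivsAt.of_contDiffAt hC
  have hline : ∀ t : ℝ, c.finsler ⟨p, v + t • u⟩ =
      c.F ⟨p, c.projFibre p v + t • c.projFibre p u⟩ := by
    intro t
    rw [finsler_mk, map_add, map_smul]
  have hv0 := c.form_projFibre p v
  have hu0 := c.form_projFibre p u
  refine ⟨_, _, h2, ?_, ?_⟩
  · simp_rw [hline]
    exact c.deriv_deriv_finsler_sq_pos hv0 hv hu0 hu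
  -- Every direction `π u + z π v` lies in `ker Ω`, so the positivity hypothesis on `F` applies to
  -- it unless it is zero, when the function is constant.
  · have key := sq_le_of_homogeneous h2 (m := fun z t => c.F ⟨p, c.projFibre p v +
      t • (c.projFibre p u + z • c.projFibre p v)⟩ ^ 2) ?_ ?_ ?_
    · simpa using key
    · have := c.finsler_pos hv
      simp only [zero_smul, add_zero]
      positivity
    · intro z
      have : ContinuousAt (fun t : ℝ => 1 + z * t) 0 := by fun_prop
      filter_upwards [this.eventually (lt_mem_nhds (show (0 : ℝ) < 1 + z * 0 by simp))] with t ht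
      rw [hline, ← mul_pow, ← c.F_smul p _ _ _ ht]
      · congr 3
        have h3 : (1 + z * t) * (t / (1 + z * t)) = t := mul_div_cancel₀ t ht.ne'
        rw [smul_add (1 + z * t), smul_smul (1 + z * t), h3]
        module
      · have := c.form_add_smul p (c.projFibre p v) (c.projFibre p u) (t / (1 + z * t))
        rw [hv0, hu0, mul_zero, add_zero] at this
        exact this
    · intro z
      by_cases h0 : c.projFibre p u + z • c.projFibre p v = 0
      · simp [h0]
      · refine (c.deriv_deriv_finsler_sq_pos hv0 hv ?_ h0).le
        rw [form_add_smul, hv0, hu0, mul_zero, add_zero]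

/-- The graph function of the smoothed indicatrix over `ker Ω`, extended to `TM`. -/
def smoothedGraph (B : ∀ p : M, LinearMap.BilinForm ℝ (TangentSpace (𝓡 n) p)) (α : M → ℝ)
    (v : TangentBundle (𝓡 n) M) : ℝ :=
  smoothedProfile (α v.proj) (B v.proj (c.projFibre v.proj v.snd) (c.projFibre v.proj v.snd))
    (c.finsler v ^ 2)

variable {B : ∀ p : M, LinearMap.BilinForm ℝ (TangentSpace (𝓡 n) p)} {α : M → ℝ}

theorem bilin_le (hB : ∀ p v, c.form ⟨p, v⟩ = 0 → 4 * B p v v ≤ c.F ⟨p, v⟩ ^ 2) (p : M)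
    (v : TangentSpace (𝓡 n) p) :
    4 * B p (c.projFibre p v) (c.projFibre p v) ≤ c.finsler ⟨p, v⟩ ^ 2 :=
  hB p _ (c.form_projFibre p v)

theorem smoothedGraph_add_smul_field (p : M) (v : TangentSpace (𝓡 n) p) (t : ℝ) :
    c.smoothedGraph B α ⟨p, v + t • c.T p⟩ = c.smoothedGraph B α ⟨p, v⟩ := by
  unfold smoothedGraph
  simp only
  rw [finsler_add_smul_field, map_add, map_smul, projFibre_field, smul_zero, add_zero]

theorem smoothedGraph_smul (p : M) (v : TangentSpace (𝓡 n) p) {a : ℝ} (ha : 0 < a) :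
    c.smoothedGraph B α ⟨p, a • v⟩ = smoothedProfile (α p)
      (a ^ 2 * B p (c.projFibre p v) (c.projFibre p v)) (a ^ 2 * c.finsler ⟨p, v⟩ ^ 2) := by
  unfold smoothedGraph
  simp only
  rw [finsler_smul _ _ _ ha, mul_pow]
  congr 1
  simp only [map_smul, LinearMap.smul_apply, smul_eq_mul]
  ring

/-- Where `F ∘ π` vanishes, the graph function is a Euclidean one up to a constant. -/
theorem eventually_smoothedGraph_eq (hα : ContMDiff (𝓡 n) 𝓘(ℝ, ℝ) k α)
    (hα0 : ∀ p, 0 < α p ∧ α p ≤ 1)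
    (hBc : ContMDiff (𝓡 n).tangent 𝓘(ℝ, ℝ) k
      fun v : TangentBundle (𝓡 n) M => B v.proj v.snd v.snd)
    {v : TangentBundle (𝓡 n) M} (hv : c.projFibre v.proj v.snd = 0) :
    ∀ᶠ w : TangentBundle (𝓡 n) M in 𝓝 v, c.smoothedGraph B α w =
      √(1 + α w.proj + B w.proj (c.projFibre w.proj w.snd) (c.projFibre w.proj w.snd)) -
        α w.proj / 6 * (1 - smoothRamp 1) := by
  have hαc : Continuous fun w : TangentBundle (𝓡 n) M => α w.proj :=
    hα.continuous.comp (FiberBundle.continuous_proj _ _)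
  have hbc : Continuous fun w : TangentBundle (𝓡 n) M =>
      B w.proj (c.projFibre w.proj w.snd) (c.projFibre w.proj w.snd) :=
    hBc.continuous.comp c.contMDiff_projection.continuous
  have hlc := c.continuous_finsler
  have h1 : Continuous fun w : TangentBundle (𝓡 n) M => √(1 + α w.proj +
      B w.proj (c.projFibre w.proj w.snd) (c.projFibre w.proj w.snd)) -
        (√(1 + c.finsler w ^ 2) + α w.proj / 6) :=
    (((continuous_const.add hαc).add hbc).sqrt).sub
      (((continuous_const.add (hlc.pow 2)).sqrt).add (hαc.div_const 6))
  have h2 : 0 < √(1 + α v.proj +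
      B v.proj (c.projFibre v.proj v.snd) (c.projFibre v.proj v.snd)) -
        (√(1 + c.finsler v ^ 2) + α v.proj / 6) := by
    rw [hv, show c.finsler v = 0 from c.finsler_eq_zero hv]
    obtain ⟨h0, h1⟩ := hα0 v.proj
    -- The scale `α/6` is small enough for `(1 + α/6)² < 1 + α` when `0 < α ≤ 1`.
    have : 1 + α v.proj / 6 < √(1 + α v.proj) := Real.lt_sqrt_of_sq_lt (by nlinarith)
    simp only [map_zero, add_zero, ne_eq, OfNat.ofNat_ne_zero, not_false_eq_true, zero_pow,
      Real.sqrt_one]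
    linarith
  filter_upwards [h1.continuousAt.eventually (lt_mem_nhds h2)] with w hw
  exact smoothedProfile.eq_sqrt_sub (hα0 w.proj).1 (by linarith)

theorem contMDiff_smoothedGraph (hα : ContMDiff (𝓡 n) 𝓘(ℝ, ℝ) k α)
    (hα0 : ∀ p, 0 < α p ∧ α p ≤ 1)
    (hBc : ContMDiff (𝓡 n).tangent 𝓘(ℝ, ℝ) k
      fun v : TangentBundle (𝓡 n) M => B v.proj v.snd v.snd)
    (hB : ∀ p v, v ≠ 0 → 0 < B p v v) :
    ContMDiff (𝓡 n).tangent 𝓘(ℝ, ℝ) k (c.smoothedGraph B α) := by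
  intro v
  have hα' : ContMDiffAt (𝓡 n).tangent 𝓘(ℝ, ℝ) k
      (fun w : TangentBundle (𝓡 n) M => α w.proj) v := (hα v.proj).comp v (contMDiffAt_proj _)
  have hb : ContMDiffAt (𝓡 n).tangent 𝓘(ℝ, ℝ) k (fun w : TangentBundle (𝓡 n) M =>
      B w.proj (c.projFibre w.proj w.snd) (c.projFibre w.proj w.snd)) v :=
    (hBc _).comp v (c.contMDiff_projection v)
  by_cases h : c.projFibre v.proj v.snd = 0
  · refine ContMDiffAt.congr_of_eventuallyEq ?_ (c.eventually_smoothedGraph_eq hα hα0 hBc h)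
    have hq : ContDiffAt ℝ k (fun q : ℝ × ℝ => √(1 + q.1 + q.2) - q.1 / 6 * (1 - smoothRamp 1))
        (α v.proj, B v.proj (c.projFibre v.proj v.snd) (c.projFibre v.proj v.snd)) := by
      refine ContDiffAt.sub (ContDiffAt.sqrt (by fun_prop) ?_) (by fun_prop)
      have := (hα0 v.proj).1
      have := (B v.proj).self_nonneg_of_pos (hB v.proj) (c.projFibre v.proj v.snd)
      positivity
    exact ContDiffAt.comp_contMDiffAt (f := fun w : TangentBundle (𝓡 n) M =>
      (α w.proj, B w.proj (c.projFibre w.proj w.snd) (c.projFibre w.proj w.snd)))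
      hq (hα'.prodMk_space hb)
  · have hl : ContMDiffAt (𝓡 n).tangent 𝓘(ℝ, ℝ) k (fun w => c.finsler w ^ 2) v :=
      (contDiff_id.pow 2).contDiffAt.comp_contMDiffAt (c.contMDiffAt_finsler h)
    exact ContDiffAt.comp_contMDiffAt (f := fun w : TangentBundle (𝓡 n) M =>
      (α w.proj, B w.proj (c.projFibre w.proj w.snd) (c.projFibre w.proj w.snd),
        c.finsler w ^ 2))
      (smoothedProfile.contDiffAt k (hα0 v.proj).1 ((B _).self_nonneg_of_pos (hB _) _) (sq_nonneg _))
      (hα'.prodMk_space (hb.prodMk_space hl))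

/-- The graph function is strongly convex in the directions of `ker Ω`. -/
theorem hasTwoDerivsAt_smoothedGraph (hk : 2 ≤ k) (hα : ContMDiff (𝓡 n) 𝓘(ℝ, ℝ) k α)
    (hα0 : ∀ p, 0 < α p ∧ α p ≤ 1)
    (hBc : ContMDiff (𝓡 n).tangent 𝓘(ℝ, ℝ) k
      fun v : TangentBundle (𝓡 n) M => B v.proj v.snd v.snd)
    (hB : ∀ p v, v ≠ 0 → 0 < B p v v)
    (p : M) (v : TangentSpace (𝓡 n) p) {u : TangentSpace (𝓡 n) p} (hu : c.projFibre p u ≠ 0) :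
    ∃ d₁ d₂, HasTwoDerivsAt (fun t : ℝ => c.smoothedGraph B α ⟨p, v + t • u⟩) d₁ d₂ 0 ∧
      0 < d₂ := by
  have hα1 := (hα0 p).1
  obtain ⟨b₁, b₂, hb, hb2, hb12⟩ := (B p).hasTwoDerivsAt_line (hB p) (c.projFibre p v) hu
  have hb0 := (B p).self_nonneg_of_pos (hB p) (c.projFibre p v)
  -- Over the zero of `π` the function `F²` may lack a second derivative, so the local expression
  -- without `F` is used there.
  by_cases hv : c.projFibre p v = 0
  · obtain ⟨e₁, e₂, he, he2⟩ := hb.sqrt_const_add (b := 1 + α p) (by linarith)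
      (by simpa using hb0) hb2 (by simpa using hb12)
    refine ⟨_, _, (he.add (HasTwoDerivsAt.const
      (-(α p / 6 * (1 - smoothRamp 1))))).congr_of_eventuallyEq ?_, by simpa using he2⟩
    have hc : ContinuousAt (fun t : ℝ => (⟨p, v + t • u⟩ : TangentBundle (𝓡 n) M)) 0 :=
      (contMDiff_tangentLine k p v u).continuous.continuousAt
    have hev := c.eventually_smoothedGraph_eq hα hα0 hBc
      (v := (⟨p, v + (0 : ℝ) • u⟩ : TangentBundle (𝓡 n) M)) (by simpa using hv)
    filter_upwards [hc.eventually hev] with t ht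
    rw [ht]
    simp only [map_add, map_smul]
    ring
  · obtain ⟨l₁, l₂, hl, hl2, hl12⟩ := c.hasTwoDerivsAt_finsler_sq hk hv hu
    obtain ⟨e₁, e₂, he, he2⟩ := smoothedProfile.hasTwoDerivsAt hα1 hb hl (by simpa using hb0) hb2
      (by simpa using hb12) (sq_nonneg _) hl2 (by simpa using hl12)
    refine ⟨e₁, e₂, he.congr_of_eventuallyEq (.of_forall fun t => ?_), he2⟩
    unfold smoothedGraph
    simp only [map_add, map_smul]

/-- On each ray the graph function lies above its tangent through the origin. -/
theorem hasDerivAt_smoothedGraph_ray (hα0 : ∀ p, 0 < α p ∧ α p ≤ 1)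
    (hB : ∀ p v, v ≠ 0 → 0 < B p v v)
    (hB' : ∀ p v, c.form ⟨p, v⟩ = 0 → 4 * B p v v ≤ c.F ⟨p, v⟩ ^ 2)
    (p : M) (v : TangentSpace (𝓡 n) p) :
    ∃ d, HasDerivAt (fun t : ℝ => c.smoothedGraph B α ⟨p, v + t • v⟩) d 0 ∧
      d < c.smoothedGraph B α ⟨p, v⟩ := by
  obtain ⟨d, hd, hlt⟩ := smoothedProfile.hasDerivAt_ray (a := 1) (hα0 p).1 (hα0 p).2
    ((B p).self_nonneg_of_pos (hB p) (c.projFibre p v)) (c.bilin_le hB' p v)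
  refine ⟨d, ?_, ?_⟩
  · have h1 : HasDerivAt (fun t : ℝ => 1 + t) 1 0 := (hasDerivAt_id' (0 : ℝ)).const_add 1
    have h2 := HasDerivAt.comp (0 : ℝ) (h := fun t : ℝ => 1 + t)
      (by simpa only [add_zero] using hd) h1
    rw [mul_one] at h2
    refine h2.congr_of_eventuallyEq ?_
    filter_upwards [lt_mem_nhds (show (-1 : ℝ) < 0 by norm_num)] with t ht
    rw [show v + t • v = (1 + t) • v by module, c.smoothedGraph_smul p v (by linarith)]
    rfl
  · rw [one_mul, ← c.smoothedGraph_smul p v one_pos, one_smul] at hlt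
    exact hlt

end ConeTriple

/-! ### The smoothed indicatrix. -/

theorem mainTheorem5 {n : ℕ} (hn : 2 ≤ n) {M : Type*} [TopologicalSpace M] [T2Space M]
    [SecondCountableTopology M] [ChartedSpace (EuclideanSpace ℝ (Fin n)) M]
    [IsManifold (𝓡 n) ∞ M] (k : ℕ∞) (hk : 2 ≤ k) (c : ConeTriple n M k)
    (U : Set (TangentBundle (𝓡 n) M)) (hU : U ∈ 𝓝ˢ (Set.range c.field)) :
    ∃ S : Set (TangentBundle (𝓡 n) M),
      IsHypersurface (𝓡 n).tangent k S ∧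
      (∀ v : TangentBundle (𝓡 n) M, v ∉ U → (v ∈ S ↔ v ∈ c.indicatrix)) ∧
      S ⊆ c.coneDomain ∧
      (∀ (p : M) (v : TangentSpace (𝓡 n) p),
        (⟨p, v⟩ : TangentBundle (𝓡 n) M) ∈ c.coneDomain →
        ∃! a : ℝ, 0 < a ∧ (⟨p, a • v⟩ : TangentBundle (𝓡 n) M) ∈ S) ∧
      (∀ v ∈ S, IsRadiallyTransverseAt k S v) ∧
      (∀ v ∈ S, IsFibreStronglyConvexAt k S v) := by
  obtain ⟨B, hBc, hB⟩ := c.exists_riemannian_le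
  obtain ⟨α, hα⟩ := c.exists_smooth_size hU
  have hB1 : ∀ p v, v ≠ 0 → 0 < B p v v := fun p => (hB p).1
  have hB2 : ∀ p v, c.form ⟨p, v⟩ = 0 → 4 * B p v v ≤ c.F ⟨p, v⟩ ^ 2 := fun p => (hB p).2
  have hα0 : ∀ p, 0 < α p ∧ α p ≤ 1 := fun p => ⟨(hα p).1, (hα p).2.1⟩
  have hBk : ContMDiff (𝓡 n).tangent 𝓘(ℝ, ℝ) k
      fun v : TangentBundle (𝓡 n) M => B v.proj v.snd v.snd := hBc.of_le (mod_cast le_top)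
  set φ := c.smoothedGraph B α with hφ
  have hφc : ContMDiff (𝓡 n).tangent 𝓘(ℝ, ℝ) k φ :=
    c.contMDiff_smoothedGraph α.contMDiff hα0 hBk hB1
  set f : TangentBundle (𝓡 n) M → ℝ := fun v => c.form v - φ v with hf
  have hfc : ContMDiff (𝓡 n).tangent 𝓘(ℝ, ℝ) k f := c.contMDiff_form.sub hφc
  have hmf : ∀ v, mfderiv (𝓡 n).tangent 𝓘(ℝ, ℝ) f v ≠ 0 := by
    rintro ⟨p, v⟩ h0
    -- `φ` is invariant under translation by `T` and `Ω(T) = 1`, so `f` has derivative `1` along the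
    -- vertical line in direction `T`; this shows `df ≠ 0` on all of `TM`.
    have hγ := contMDiff_tangentLine k p v (c.T p)
    have hk1 : (k : WithTop ℕ∞) ≠ 0 := by
      have : k ≠ 0 := fun h => by simp [h] at hk
      exact_mod_cast this
    have h1 : MDifferentiableAt 𝓘(ℝ, ℝ) (𝓡 n).tangent
        (fun t : ℝ => (⟨p, v + t • c.T p⟩ : TangentBundle (𝓡 n) M)) 0 :=
      (hγ 0).mdifferentiableAt hk1
    have h2 : MDifferentiableAt (𝓡 n).tangent 𝓘(ℝ, ℝ) f
        (⟨p, v + (0 : ℝ) • c.T p⟩ : TangentBundle (𝓡 n) M) := (hfc _).mdifferentiableAt hk1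
    have h3 := mfderiv_comp (0 : ℝ) h2 h1
    have h4 : (f ∘ fun t : ℝ => (⟨p, v + t • c.T p⟩ : TangentBundle (𝓡 n) M)) =
        fun t => f ⟨p, v⟩ + t := by
      funext t
      simp only [hf, Function.comp, hφ]
      rw [c.smoothedGraph_add_smul_field, c.form_add_smul, c.form_field]
      ring
    have h5 : mfderiv (𝓡 n).tangent 𝓘(ℝ, ℝ) f
        (⟨p, v + (0 : ℝ) • c.T p⟩ : TangentBundle (𝓡 n) M) = 0 := by
      have : (⟨p, v + (0 : ℝ) • c.T p⟩ : TangentBundle (𝓡 n) M) = ⟨p, v⟩ := by simp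
      rw [this]
      exact h0
    rw [h4, h5, ContinuousLinearMap.zero_comp, mfderiv_eq_fderiv] at h3
    have h6 : HasDerivAt (fun t : ℝ => f ⟨p, v⟩ + t) 1 0 := (hasDerivAt_id' (0 : ℝ)).const_add _
    have h7 : fderiv ℝ (fun t : ℝ => f ⟨p, v⟩ + t) 0 1 = 0 := by
      rw [h3]; rfl
    rw [fderiv_apply_one_eq_deriv, h6.deriv] at h7
    exact one_ne_zero h7
  have hloc : ∀ v, IsLocalEquation (𝓡 n).tangent k {v | f v = 0} v f := fun v =>
    ⟨Set.univ, isOpen_univ, Set.mem_univ v, hfc.contMDiffOn, fun y _ => hmf y, fun y _ => Iff.rfl⟩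
  have htrans : ∀ v : TangentBundle (𝓡 n) M, f v = 0 →
      0 < lineDeriv ℝ (fibreRestrict f v.proj) v.snd v.snd := by
    rintro ⟨p, v⟩ hv
    obtain ⟨d, hd, hlt⟩ := c.hasDerivAt_smoothedGraph_ray hα0 hB1 hB2 p v
    have hform : HasDerivAt (fun t : ℝ => c.form ⟨p, v + t • v⟩) (c.form ⟨p, v⟩) 0 := by
      simp_rw [c.form_add_smul]
      simpa using ((hasDerivAt_id' (0 : ℝ)).mul_const (c.form ⟨p, v⟩)).const_add (c.form ⟨p, v⟩)
    have : lineDeriv ℝ (fibreRestrict f p) v v = c.form ⟨p, v⟩ - d := (hform.fun_sub hd).deriv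
    rw [this]
    have hv' : c.form ⟨p, v⟩ - φ ⟨p, v⟩ = 0 := hv
    linarith
  refine ⟨{v | f v = 0}, fun v _ => ⟨f, hloc v⟩, ?_, ?_, ?_,
    fun v hv => ⟨f, hloc v, (htrans v hv).ne'⟩, fun v hv => ⟨f, hloc v, (htrans v hv).ne', ?_⟩⟩
  · rintro ⟨p, v⟩ hvU
    have hind : (⟨p, v⟩ : TangentBundle (𝓡 n) M) ∈ c.indicatrix ↔
        c.form ⟨p, v⟩ = √(1 + c.finsler ⟨p, v⟩ ^ 2) := by
      change (c.form ⟨p, v⟩ ^ 2 - c.finsler ⟨p, v⟩ ^ 2 = 1 ∧ 0 < c.form ⟨p, v⟩) ↔ _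
      constructor
      · rintro ⟨h1, h2⟩
        rw [← h1, sub_add_cancel, Real.sqrt_sq h2.le]
      · intro h
        rw [h, Real.sq_sqrt (by positivity)]
        exact ⟨by ring, Real.sqrt_pos.2 (by positivity)⟩
    rw [hind]
    change c.form ⟨p, v⟩ - φ ⟨p, v⟩ = 0 ↔ _
    rw [sub_eq_zero]
    set b := B p (c.projFibre p v) (c.projFibre p v)
    have hb0 : 0 ≤ b := (B p).self_nonneg_of_pos (hB1 p) _
    have hbl : 4 * b ≤ c.finsler ⟨p, v⟩ ^ 2 := c.bilin_le hB2 p v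
    have hφp : φ ⟨p, v⟩ = smoothedProfile (α p) b (c.finsler ⟨p, v⟩ ^ 2) := rfl
    obtain ⟨ha, ha1, haU⟩ := hα p
    -- Either the profile is unchanged, or `F² < α + b` with `4 b ≤ F²`. In the second case a point
    -- of either hypersurface has `1 ≤ Ω ≤ √(1 + 2α)`, so it would lie in `U`.
    rcases le_or_gt (α p + b) (c.finsler ⟨p, v⟩ ^ 2) with h | h
    · rw [hφp, smoothedProfile.eq_sqrt ha h]
    · have hF : c.finsler ⟨p, v⟩ ^ 2 ≤ 2 * α p := by linarith
      have h1 : 1 ≤ √(1 + c.finsler ⟨p, v⟩ ^ 2) := Real.one_le_sqrt.2 (by nlinarith)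
      have h2 : √(1 + c.finsler ⟨p, v⟩ ^ 2) ≤ √(1 + 2 * α p) := Real.sqrt_le_sqrt (by linarith)
      have h3 : φ ⟨p, v⟩ ≤ √(1 + 2 * α p) := by
        rw [hφp]
        exact (smoothedProfile.le_sqrt ha h.le).trans (Real.sqrt_le_sqrt (by linarith))
      have h4 : √(1 + c.finsler ⟨p, v⟩ ^ 2) ≤ φ ⟨p, v⟩ := smoothedProfile.sqrt_le ha
      exact ⟨fun h => absurd (haU v hF (by linarith) (by linarith)) hvU,
        fun h => absurd (haU v hF (by linarith) (by linarith)) hvU⟩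
  · rintro ⟨p, v⟩ hv
    have hv' : c.form ⟨p, v⟩ - φ ⟨p, v⟩ = 0 := hv
    have h1 : √(1 + c.finsler ⟨p, v⟩ ^ 2) ≤ φ ⟨p, v⟩ := smoothedProfile.sqrt_le (hα0 p).1
    have h2 : c.finsler ⟨p, v⟩ < √(1 + c.finsler ⟨p, v⟩ ^ 2) :=
      Real.lt_sqrt_of_sq_lt (by linarith)
    change c.finsler ⟨p, v⟩ < c.form ⟨p, v⟩
    linarith
  · intro p v hv
    have hv' : c.finsler ⟨p, v⟩ < c.form ⟨p, v⟩ := hv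
    have h0 := c.finsler_nonneg ⟨p, v⟩
    have key := smoothedProfile.existsUnique_ray (t := c.form ⟨p, v⟩) (hα0 p).1 (hα0 p).2
      ((B p).self_nonneg_of_pos (hB1 p) (c.projFibre p v)) (c.bilin_le hB2 p v) (by linarith)
      (by nlinarith)
    refine (existsUnique_congr fun a => and_congr_right fun ha => ?_).1 key
    change _ ↔ c.form ⟨p, a • v⟩ - c.smoothedGraph B α ⟨p, a • v⟩ = 0
    rw [c.form_smul, c.smoothedGraph_smul p v ha, sub_eq_zero]
  · intro X hX0 hX
    obtain ⟨p, v⟩ := v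
    simp only at X hX0 hX ⊢
    have hform : HasTwoDerivsAt (fun t : ℝ => c.form ⟨p, v + t • X⟩) (c.form ⟨p, X⟩) 0 0 := by
      simp_rw [c.form_add_smul]
      exact ((HasTwoDerivsAt.const _).add (HasTwoDerivsAt.id.mul
        (HasTwoDerivsAt.const (c.form ⟨p, X⟩)))).congr_derivs (by ring) (by ring)
    -- A tangent vector parallel to `T` vanishes, since `df(X) = Ω(X)` for such `X`.
    by_cases hXp : c.projFibre p X = 0
    · exfalso
      have hXT : X = c.form ⟨p, X⟩ • c.T p := sub_eq_zero.1 hXp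
      have h1 : ∀ t : ℝ, f ⟨p, v + t • X⟩ = f ⟨p, v⟩ + t * c.form ⟨p, X⟩ := by
        intro t
        simp only [hf, c.form_add_smul]
        have : φ ⟨p, v + t • X⟩ = φ ⟨p, v⟩ := by
          rw [hXT, smul_smul]
          exact c.smoothedGraph_add_smul_field p v _
        rw [this]
        ring
      have h2 : HasDerivAt (fun t : ℝ => f ⟨p, v + t • X⟩) (c.form ⟨p, X⟩) 0 := by
        simp_rw [h1]
        simpa using ((hasDerivAt_id' (0 : ℝ)).mul_const (c.form ⟨p, X⟩)).const_add (f ⟨p, v⟩)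
      have h3 : c.form ⟨p, X⟩ = 0 := h2.deriv.symm.trans hX
      rw [h3, zero_smul] at hXT
      exact hX0 hXT
    · obtain ⟨d₁, d₂, hd, hd2⟩ := c.hasTwoDerivsAt_smoothedGraph hk α.contMDiff hα0 hBk hB1 p v hXp
      have h1 : HasTwoDerivsAt (fun t : ℝ => f ⟨p, v + t • X⟩) (c.form ⟨p, X⟩ - d₁) (-d₂) 0 :=
        ((hform.add ((HasTwoDerivsAt.const (-1)).mul hd)).congr_of_eventuallyEq
          (.of_forall fun t => by simp only [hf, hφ]; ring)).congr_derivs (by ring) (by ring)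
      unfold positionSecondFundamentalForm
      rw [secondLineDeriv_self]
      -- `Ω` is linear on fibres, so `-D²f(X, X) = D²φ(X, X)`, and the denominator `df(v)` is
      -- positive.
      refine div_pos ?_ (htrans ⟨p, v⟩ hv)
      have h2 : deriv (deriv fun t : ℝ => fibreRestrict f p (v + t • X)) 0 = -d₂ := h1.deriv_deriv
      rw [h2]
      linarith

end
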